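/- **Setting.** There are $n\ge 1$ bidders with values $s=(s_1,\dots,s_n)\in\mathbb R_{\ge0}^n$ drawn from an instance (joint distribution) $\mathcal F$; let $s_{(1)}\ge s_{(2)}$ be the highest and second-highest values ($s_{(2)}=0$ if $n=1$). The second-price auction with anonymous reserve $r\ge 0$ collects $r\cdot\mathbf 1\{s_{(1)}\ge r>s_{(2)}\}+s_{(2)}\cdot\mathbf 1\{s_{(2)}\ge r\}$. Let $\mathsf{AR}(r,\mathcal F)$ be the expectation of this revenue and $\mathsf{AR}(\mathcal F)=\sup_{r\ge0}\mathsf{AR}(r,\mathcal F)$. CDFs are left-continuous: $F(v)=\Pr\{s<v\}$. If only the CDFs $F_1,F_2$ of the highest and second-highest values are given, $\mathsf{AR}(r,F_1\uplus F_2)=r\,(1-F_1(r))+\int_r^\infty(1-F_2(x))\,dx$. **Algorithm.** Input: $\delta\in(0,1)$ and $m$ independent samples from $\mathcal F$ (the rows of an $m\times n$ matrix). For $i\in\{1,2\}$ let $E_i$ be the (left-continuous) empirical CDF of the $m$ row-wise $i$-th highest entries, let $\beta=\ln(8m/\delta)/m$, and let $$\widetilde E_i(v)=\min\Big\{1,\;E_i(v)+\sqrt{2\beta\,E_i(v)\,(1-E_i(v))}+4\beta\Big\},\qquad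 v\ge 0.$$ Output: a reserve $\hat r\ge 0$ maximizing $r\mapsto\mathsf{AR}(r,\widetilde E_1\uplus\widetilde E_2)$ over $r\ge0$, with ties broken arbitrarily. **Distributions.** A single-value distribution on $\mathbb R_{\ge 0}$ is *continuous* if its support is an interval and it has no atoms except possibly one at the supremum of its support. It is *continuous regular* if moreover it has a positive density $f$ in the interior of its support, where $v\mapsto v-\frac{1-F(v)}{f(v)}$ is non-decreasing. It is *continuous MHR* if it is continuous and $G(v)=\ln(1-F(v))$ is concave on its support (with value $-\infty$ where $F=1$). It is *discrete MHR* if for some $\Delta>0$ it is supported on $\{k\Delta: k=1,2,\dots\}$ and the piecewise linear function through $(0,0)$ and the points $(k\Delta,G(k\Delta))$, $k\ge1$, is concave (with value $-\infty$ beyond the largest support point). **Theorem.** There is an absolute constant $C>0$ such that for all $\varepsilon,\delta\in(0,1)$, all $n\ge1$ and all $m$: with probability at least $1-\delta$ over the $m$ samples, the algorithm has an output, and every possible output $\hat r$ satisfies 1. $\mathsf{AR}(\hat r,\mathcal F)\ge\mathsf{AR}(\mathcal F)-\varepsilon$, if $\mathcal F$ is any (possibly correlated) distribution supported on $[0,1]^n$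 and $m\ge C\,\varepsilon^{-2}(\ln\varepsilon^{-1}+\ln\delta^{-1}+1)$; 2. $\mathsf{AR}(\hat r,\mathcal F)\ge(1-\varepsilon)\,\mathsf{AR}(\mathcal F)$, if $\mathcal F$ is any (possibly correlated) distribution supported on $[1,H]^n$ for a real $H\ge1$ and $m\ge C\,\varepsilon^{-2}H\,(\ln\varepsilon^{-1}+\ln H+\ln\delta^{-1}+1)$; 3. $\mathsf{AR}(\hat r,\mathcal F)\ge(1-\varepsilon)\,\mathsf{AR}(\mathcal F)$, if the values are independent, each with a continuous regular distribution, and $m\ge C\,\varepsilon^{-3}(\ln\varepsilon^{-1}+\ln\delta^{-1}+1)$; 4. $\mathsf{AR}(\hat r,\mathcal F)\ge(1-\varepsilon)\,\mathsf{AR}(\mathcal F)$, if the values are independent, each with an MHR distribution (continuous MHR or discrete MHR), and $m\ge C\,\varepsilon^{-2}(\ln\varepsilon^{-1}+\ln\delta^{-1}+1)$. -/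

import Mathlib

open MeasureTheory Set
open scoped ENNReal

noncomputable section

namespace AnonymousReserve

/-! ### Order statistics and the second-price auction with an anonymous reserve -/

/-- The `i`-th entry (counted from `i = 0`) of the value vector `s` after reordering it
decreasingly; `0` if there are at most `i` bidders. `Tuple.sort s` is the permutation for which
`s ∘ Tuple.sort s` is non-decreasing. -/
def nthHighest {n : ℕ} (i : ℕ) (s : Fin n → ℝ) : ℝ :=
  if h : i < n then s (Tuple.sort s (Fin.rev ⟨i, h⟩)) else 0

/-- The highest value. -/
def highest {n : ℕ} (s : Fin n → ℝ) : ℝ := nthHighest 0 s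

/-- The second-highest value (`0` if there is only one bidder). -/
def secondHighest {n : ℕ} (s : Fin n → ℝ) : ℝ := nthHighest 1 s

/-- Payment collected by the auction with reserve `r` on the value vector `s`: nothing if nobody
reaches `r`, the reserve if only the highest value reaches it, the second-highest value if at
least two values reach it. -/
def outcomeRevenue {n : ℕ} (r : ℝ) (s : Fin n → ℝ) : ℝ :=
  if highest s < r then 0 else if secondHighest s < r then r else secondHighest s

/-- Expected revenue of the reserve `r` on the instance (joint value distribution) `μ`. -/
def expectedRevenue {n : ℕ} (r : ℝ) (μ : Measure (Fin n → ℝ)) : ℝ≥0∞ :=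
  ∫⁻ s, ENNReal.ofReal (outcomeRevenue r s) ∂μ

/-- Optimal revenue over all reserves. It is a supremum since the optimal reserve may be
infinite, i.e. the optimal revenue may only be approached as the reserve grows. -/
def optimalRevenue {n : ℕ} (μ : Measure (Fin n → ℝ)) : ℝ≥0∞ :=
  ⨆ (r : ℝ) (_ : 0 ≤ r), expectedRevenue r μ

/-- Revenue of the reserve `r` on an instance given only by the (left-continuous) CDFs `F₁`, `F₂`
of its highest and second-highest values. -/
def cdfRevenue (r : ℝ) (F₁ F₂ : ℝ → ℝ) : ℝ≥0∞ :=
  ENNReal.ofReal (r * (1 - F₁ r)) + ∫⁻ x in Ioi r, ENNReal.ofReal (1 - F₂ x)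

/-! ### The empirical algorithm -/

/-- The parameter `β = ln (8 m / δ) / m`. -/
def beta (m : ℕ) (δ : ℝ) : ℝ := Real.log (8 * m / δ) / m

/-- The shading function `x ↦ min {1, x + √(2 β x (1 - x)) + 4 β}`. -/
def shade (β x : ℝ) : ℝ := min 1 (x + √(2 * β * x * (1 - x)) + 4 * β)

/-- Left-continuous CDF of the empirical distribution of the `i`-th highest sample values: the
fraction of the rows of the sample matrix `S` whose `i`-th highest entry is less than `v`. -/
def empiricalCDF {m n : ℕ} (S : Fin m → Fin n → ℝ) (i : ℕ) (v : ℝ) : ℝ :=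
  (Nat.card {t : Fin m // nthHighest i (S t) < v} : ℝ) / m

/-- The shaded empirical CDF of the `i`-th highest value. -/
def shadedEmpiricalCDF {m n : ℕ} (δ : ℝ) (S : Fin m → Fin n → ℝ) (i : ℕ) (v : ℝ) : ℝ :=
  shade (beta m δ) (empiricalCDF S i v)

/-- `r` is a possible output of the empirical algorithm on the sample matrix `S` (run with failing
probability `δ`), i.e. an optimal reserve for the shaded empirical instance. Every maximizer is a
possible output, as ties may be broken in any way. -/
def IsAlgorithmOutput {m n : ℕ} (δ : ℝ) (S : Fin m → Fin n → ℝ) (r : ℝ) : Prop :=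
  0 ≤ r ∧ ∀ r' : ℝ, 0 ≤ r' →
    cdfRevenue r' (shadedEmpiricalCDF δ S 0) (shadedEmpiricalCDF δ S 1) ≤
      cdfRevenue r (shadedEmpiricalCDF δ S 0) (shadedEmpiricalCDF δ S 1)

/-- With probability at least `1 - δ` over `m` independent samples from `μ`, the algorithm has an
output, and each of its possible outputs `r` satisfies `good r`. (The event contains a measurable
event of probability at least `1 - δ`.) -/
def LearnsReserve {n : ℕ} (μ : Measure (Fin n → ℝ)) (m : ℕ) (δ : ℝ) (good : ℝ → Prop) : Prop :=
  ∃ A : Set (Fin m → Fin n → ℝ), MeasurableSet A ∧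
    ENNReal.ofReal (1 - δ) ≤ Measure.pi (fun _ : Fin m => μ) A ∧
    ∀ S ∈ A, (∃ r, IsAlgorithmOutput δ S r) ∧ ∀ r, IsAlgorithmOutput δ S r → good r

/-! ### Regular and MHR distributions of a single value -/

/-- The left-continuous CDF `F(v) = Pr {s < v}`. -/
def leftCDF (ν : Measure ℝ) (v : ℝ) : ℝ := ν.real (Iio v)

/-- A continuous distribution of a non-negative value: it is supported on an interval and has no
atoms, except possibly one at the supremum of the support. -/
structure IsContinuousDist (ν : Measure ℝ) : Prop where
  nonneg : ν (Iio 0) = 0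
  interval : ν.support.OrdConnected
  atom : ∀ x, ν {x} ≠ 0 → x ∈ upperBounds ν.support

/-- A continuous regular distribution: there is a (positive) density `f` inside the support such
that the virtual value function `v ↦ v - (1 - F(v)) / f(v)` is non-decreasing there. -/
def IsRegular (ν : Measure ℝ) : Prop :=
  IsContinuousDist ν ∧ ∃ f : ℝ → ℝ, Measurable f ∧
    (∀ v ∈ interior ν.support, 0 < f v) ∧
    ν.restrict (interior ν.support) =
      (volume.restrict (interior ν.support)).withDensity (fun v => ENNReal.ofReal (f v)) ∧
    MonotoneOn (fun v => v - (1 - leftCDF ν v) / f v) (interior ν.support)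

/-- The function `G(v) = ln (1 - F(v))`. It is used only where `F(v) < 1`. -/
def logSurvival (ν : Measure ℝ) (v : ℝ) : ℝ := Real.log (1 - leftCDF ν v)

/-- A continuous MHR distribution: `G` is concave on the support. (Where `F(v) = 1`, which within
the support can happen only at its supremum, `G` is `-∞`.) -/
def IsContinuousMHR (ν : Measure ℝ) : Prop :=
  IsContinuousDist ν ∧ ConcaveOn ℝ {v | v ∈ ν.support ∧ leftCDF ν v < 1} (logSurvival ν)

/-- The piecewise linear function through the points `(k * Δ, G(k * Δ))`, `k = 0, 1, 2, …`. -/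
def piecewiseLogSurvival (ν : Measure ℝ) (Δ v : ℝ) : ℝ :=
  logSurvival ν (⌊v / Δ⌋₊ * Δ) +
    (v / Δ - ⌊v / Δ⌋₊) *
      (logSurvival ν ((⌊v / Δ⌋₊ + 1) * Δ) - logSurvival ν (⌊v / Δ⌋₊ * Δ))

/-- A discrete MHR distribution with step-size `Δ`: it is supported on `{k * Δ | k ≥ 1}` and the
piecewise linear function through `(0, 0)` and the points `(k * Δ, G(k * Δ))` is concave. (Beyond
the largest support point, where `F(v) = 1`, this function is `-∞`.) -/
def IsDiscreteMHR (ν : Measure ℝ) (Δ : ℝ) : Prop :=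
  0 < Δ ∧ (∀ᵐ v ∂ν, ∃ k : ℕ, 1 ≤ k ∧ v = k * Δ) ∧
    ConcaveOn ℝ {v | 0 ≤ v ∧ leftCDF ν v < 1} (piecewiseLogSurvival ν Δ)

/-- An MHR distribution, continuous or discrete. -/
def IsMHR (ν : Measure ℝ) : Prop :=
  IsContinuousMHR ν ∨ ∃ Δ : ℝ, IsDiscreteMHR ν Δ

end AnonymousReserve

end

/-! The revenue of a reserve depends only on the CDFs of the two highest values
(`expectedRevenue_eq_cdfRevenue`) and decreases when either CDF increases. Shading makes the
empirical CDFs pessimistic. Outside an event of probability at most `δ`, each shaded CDF lies above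
the true `F`, and by at most `3√(β(1 - F)) + 6β`, uniformly (`exists_forall_isPessimisticEstimate`:
Bernstein at `m` quantiles and a union bound). Write `AR`, `AR~` for the true and the shaded
revenue. If `r'` is an output and `r` any reserve, then `AR(r) ≤ AR~(r) + loss(r) ≤ AR~(r') +
loss(r) ≤ AR(r') + loss(r)`. Pessimism removes the error at the random point `r'`, so only the loss
at a fixed, freely chosen comparison reserve has to be bounded (`learnsReserve_of_revenueLoss`).

For bounded values, AM-GM (`loss_le`) splits the error into `η(1 - F)`, which sums to at most `η
OPT`, and a constant of order `β/η`, which contributes at most `H β/η` up to a constant factor.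
Taking `η` of order `ε` gives the first two rates; for values in `[1, H]` the additive error becomes
multiplicative because `OPT ≥ 1`.

For independent values, `1 - F₂ ≤ 4(1 - F₁)²` (`one_sub_orderCDF_one_le`), and `x(1 - F₁ x) ≤ OPT`,
so the second CDF has a tail of order `OPT²/x²`. It remains to find good comparison reserves that
are not too large. For regular values, concavity of each revenue curve
(`IsRegular.mul_one_sub_leftCDF_mul_le`) shows that reserves with sale probability at least `ε/8`
suffice up to a factor `1 - ε/4`; they are at most `8 OPT/ε`, which costs the extra factor `1/ε`.
For MHR values the survival probabilities decay geometrically, so reserves with sale probability at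
least `1/64` suffice without loss and are of order `OPT`. Moreover `√(1 - F₂)` has an integral of
order `OPT`, so the square-root error needs no AM-GM and `β` of order `ε²` is enough. -/

namespace AnonymousReserve

/-! ### Order statistics -/

/-- Counting is invariant under sorting, and in sorted order the entries reaching `v` form a final
segment. -/
lemma le_nthHighest_iff {n i : ℕ} (h : i < n) (s : Fin n → ℝ) (v : ℝ) :
    v ≤ nthHighest i s ↔ i < (Finset.univ.filter fun j => v ≤ s j).card := by
  have hmono : Monotone (s ∘ Tuple.sort s) := Tuple.monotone_sort s
  have hcard : (Finset.univ.filter fun j => v ≤ s j).card =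
      (Finset.univ.filter fun j => v ≤ s (Tuple.sort s j)).card := by
    simp only [Finset.card_filter]
    exact (Equiv.sum_comp (Tuple.sort s) fun j => if v ≤ s j then 1 else 0).symm
  rw [hcard, nthHighest, dif_pos h]
  constructor
  · intro hv
    have hsub : Finset.Ici (Fin.rev ⟨i, h⟩) ⊆
        Finset.univ.filter fun j => v ≤ s (Tuple.sort s j) := fun j hj =>
      Finset.mem_filter.2 ⟨Finset.mem_univ _, hv.trans (hmono (Finset.mem_Ici.1 hj))⟩
    have := Finset.card_le_card hsub
    rw [Fin.card_Ici, Fin.val_rev] at this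
    simp only at this
    omega
  · intro hv
    by_contra hlt
    have hsub : (Finset.univ.filter fun j => v ≤ s (Tuple.sort s j)) ⊆
        Finset.Ioi (Fin.rev ⟨i, h⟩) := fun j hj => by
      rw [Finset.mem_Ioi]
      by_contra hle
      exact hlt ((Finset.mem_filter.1 hj).2.trans (hmono (not_lt.1 hle)))
    have := Finset.card_le_card hsub
    rw [Fin.card_Ioi, Fin.val_rev] at this
    simp only at this
    omega

/-- Positivity of `v` makes the default value `0` for `i ≥ n` harmless: both sides are then false.
-/
lemma le_nthHighest_iff_of_pos {n : ℕ} (i : ℕ) (s : Fin n → ℝ) {v : ℝ} (hv : 0 < v) :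
    v ≤ nthHighest i s ↔ i < (Finset.univ.filter fun j => v ≤ s j).card := by
  rcases lt_or_ge i n with h | h
  · exact le_nthHighest_iff h s v
  · rw [nthHighest, dif_neg (not_lt.2 h)]
    have := Finset.card_le_univ (Finset.univ.filter fun j => v ≤ s j)
    rw [Fintype.card_fin] at this
    constructor <;> intro _ <;> [linarith; omega]

lemma le_highest_iff {n : ℕ} (hn : 1 ≤ n) (s : Fin n → ℝ) (v : ℝ) :
    v ≤ nthHighest 0 s ↔ ∃ j, v ≤ s j := by
  rw [le_nthHighest_iff hn, Finset.card_pos]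
  simp [Finset.Nonempty]

lemma le_secondHighest_iff {n : ℕ} (s : Fin n → ℝ) {v : ℝ} (hv : 0 < v) :
    v ≤ nthHighest 1 s ↔ ∃ i j, i ≠ j ∧ v ≤ s i ∧ v ≤ s j := by
  rw [le_nthHighest_iff_of_pos 1 s hv, Finset.one_lt_card]
  simp only [Finset.mem_filter, Finset.mem_univ, true_and]
  constructor
  · rintro ⟨a, ha, b, hb, hab⟩
    exact ⟨a, b, hab, ha, hb⟩
  · rintro ⟨a, b, hab, ha, hb⟩
    exact ⟨a, ha, b, hb, hab⟩

lemma measurable_nthHighest {n : ℕ} (i : ℕ) :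
    Measurable (nthHighest i : (Fin n → ℝ) → ℝ) := by
  rcases lt_or_ge i n with h | h
  · refine measurable_of_Ici fun v => ?_
    have : (nthHighest i : (Fin n → ℝ) → ℝ) ⁻¹' Ici v =
        (fun s => ∑ j, (Ici v).indicator (fun _ => (1 : ℕ)) (s j)) ⁻¹' Ioi i := by
      ext s
      simp only [mem_preimage, mem_Ici, mem_Ioi]
      rw [le_nthHighest_iff h, Finset.card_filter]
      simp [indicator_apply]
    rw [this]
    refine measurableSet_preimage (Finset.measurable_sum _ fun j _ => ?_) measurableSet_Ioi
    exact (measurable_const.indicator measurableSet_Ici).comp (measurable_pi_apply j)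
  · have : (nthHighest i : (Fin n → ℝ) → ℝ) = fun _ => 0 := by
      funext s
      rw [nthHighest, dif_neg (not_lt.2 h)]
    rw [this]
    exact measurable_const

lemma nthHighest_nonneg {n : ℕ} (i : ℕ) {s : Fin n → ℝ} (hs : ∀ j, 0 ≤ s j) :
    0 ≤ nthHighest i s := by
  rw [nthHighest]
  split_ifs
  · exact hs _
  · exact le_rfl

lemma nthHighest_le {n : ℕ} (i : ℕ) {s : Fin n → ℝ} {H : ℝ} (hH : 0 ≤ H) (hs : ∀ j, s j ≤ H) :
    nthHighest i s ≤ H := by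
  rw [nthHighest]
  split_ifs
  · exact hs _
  · exact hH

lemma le_highest_of_le_secondHighest {n : ℕ} {s : Fin n → ℝ} {v : ℝ} (hv : 0 < v)
    (h : v ≤ nthHighest 1 s) : v ≤ nthHighest 0 s := by
  rw [le_nthHighest_iff_of_pos _ _ hv] at h ⊢
  omega

lemma secondHighest_le_highest {n : ℕ} {s : Fin n → ℝ} (hs : ∀ j, 0 ≤ s j) :
    nthHighest 1 s ≤ nthHighest 0 s := by
  rcases (nthHighest_nonneg 1 hs).eq_or_lt with h | h
  · rw [← h]
    exact nthHighest_nonneg 0 hs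
  · exact le_highest_of_le_secondHighest h le_rfl

/-! ### The revenue in terms of the distributions of the order statistics -/

/-- The left-continuous CDF of the `i`-th highest value. -/
def orderCDF {n : ℕ} (μ : Measure (Fin n → ℝ)) (i : ℕ) (v : ℝ) : ℝ :=
  μ.real {s | nthHighest i s < v}

lemma orderCDF_nonneg {n : ℕ} (μ : Measure (Fin n → ℝ)) (i : ℕ) (v : ℝ) : 0 ≤ orderCDF μ i v :=
  measureReal_nonneg

section orderCDF

variable {n : ℕ} (μ : Measure (Fin n → ℝ)) [IsProbabilityMeasure μ] (i : ℕ)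

lemma orderCDF_le_one (v : ℝ) : orderCDF μ i v ≤ 1 := measureReal_le_one

lemma orderCDF_mono : Monotone (orderCDF μ i) := fun _ _ h =>
  measureReal_mono fun _ hs => lt_of_lt_of_le hs h

lemma one_sub_orderCDF (v : ℝ) : 1 - orderCDF μ i v = μ.real {s | v ≤ nthHighest i s} := by
  have hms : MeasurableSet {s : Fin n → ℝ | nthHighest i s < v} :=
    measurableSet_lt (measurable_nthHighest i) measurable_const
  have : {s : Fin n → ℝ | v ≤ nthHighest i s} = {s | nthHighest i s < v}ᶜ := by
    ext s
    simp
  rw [this, measureReal_compl hms, probReal_univ, orderCDF]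

lemma ofReal_one_sub_orderCDF (v : ℝ) :
    ENNReal.ofReal (1 - orderCDF μ i v) = μ {s | v ≤ nthHighest i s} := by
  rw [one_sub_orderCDF, ofReal_measureReal]

lemma measurable_orderCDF : Measurable (orderCDF μ i) := (orderCDF_mono μ i).measurable

end orderCDF

lemma setLIntegral_Ioi_comp_add_right (g : ℝ → ℝ≥0∞) (r : ℝ) :
    ∫⁻ t in Ioi 0, g (t + r) = ∫⁻ x in Ioi r, g x := by
  have h := (measurePreserving_add_right volume r).setLIntegral_comp_preimage_emb
    (measurableEmbedding_addRight r) g (Ioi r)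
  have hp : (fun t : ℝ => t + r) ⁻¹' Ioi r = Ioi 0 := by
    ext t
    simp
  rw [hp] at h
  exact h

/-- Pointwise the payment is `r` if the highest value reaches `r`, plus the positive part of the
second-highest value minus `r`. The layer-cake formula turns the expectation of the second summand
into the tail integral. -/
lemma expectedRevenue_eq_cdfRevenue {n : ℕ} (μ : Measure (Fin n → ℝ)) [IsProbabilityMeasure μ]
    (hμ : ∀ᵐ s ∂μ, ∀ j, 0 ≤ s j) {r : ℝ} (hr : 0 ≤ r) :
    expectedRevenue r μ = cdfRevenue r (orderCDF μ 0) (orderCDF μ 1) := by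
  have hm0 := measurable_nthHighest (n := n) 0
  have hm1 := measurable_nthHighest (n := n) 1
  have hpt : ∀ᵐ s ∂μ, ENNReal.ofReal (outcomeRevenue r s) =
      {s : Fin n → ℝ | r ≤ nthHighest 0 s}.indicator (fun _ => ENNReal.ofReal r) s +
        ENNReal.ofReal (max (nthHighest 1 s - r) 0) := by
    filter_upwards [hμ] with s hs
    have h10 := secondHighest_le_highest hs
    have hout : outcomeRevenue r s =
        if nthHighest 0 s < r then 0 else if nthHighest 1 s < r then r else nthHighest 1 s := rfl
    rw [hout]
    rcases lt_or_ge (nthHighest 0 s) r with h0 | h0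
    · have hmem : s ∉ {s : Fin n → ℝ | r ≤ nthHighest 0 s} := not_le.2 h0
      rw [if_pos h0, indicator_of_notMem hmem, max_eq_right (by linarith)]
      simp
    · have hmem : s ∈ {s : Fin n → ℝ | r ≤ nthHighest 0 s} := h0
      rw [if_neg (not_lt.2 h0), indicator_of_mem hmem]
      rcases lt_or_ge (nthHighest 1 s) r with h1 | h1
      · rw [if_pos h1, max_eq_right (by linarith)]
        simp
      · rw [if_neg (not_lt.2 h1), max_eq_left (by linarith),
          ← ENNReal.ofReal_add hr (by linarith)]
        congr 1
        ring
  rw [expectedRevenue, lintegral_congr_ae hpt, lintegral_add_left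
    (measurable_const.indicator (measurableSet_le measurable_const hm0)),
    lintegral_indicator (measurableSet_le measurable_const hm0), lintegral_const,
    Measure.restrict_apply_univ, ← ofReal_one_sub_orderCDF, ← ENNReal.ofReal_mul hr, cdfRevenue]
  congr 1
  rw [lintegral_eq_lintegral_meas_le μ
      (f := fun s => max (nthHighest 1 s - r) 0)
      (Filter.Eventually.of_forall fun s => le_max_right (nthHighest 1 s - r) 0)
    ((hm1.sub_const r).max measurable_const).aemeasurable,
    ← setLIntegral_Ioi_comp_add_right _ r]
  refine setLIntegral_congr_fun measurableSet_Ioi fun t ht => ?_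
  rw [ofReal_one_sub_orderCDF]
  congr 1
  ext s
  have ht' : 0 < t := ht
  change t ≤ max (nthHighest 1 s - r) 0 ↔ t + r ≤ nthHighest 1 s
  rw [le_max_iff, le_sub_iff_add_le]
  exact or_iff_left (not_le.2 ht')

/-! ### The shading function and the existence of an output -/

lemma shade_le_one (β x : ℝ) : shade β x ≤ 1 := min_le_left _ _

lemma shade_one {β : ℝ} (hβ : 0 ≤ β) : shade β 1 = 1 := by
  rw [shade, min_eq_left]
  simp [hβ]

/-- The square root decreases near `1`, possibly faster than slope `-1`, but only where the cap `1`
is active. Below the cap, `4β ≤ 1 - y` gives `2βy ≤ √(2βy(1 - y))`, hence the square root drops by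
at most `y - x`. -/
lemma shade_mono {β x y : ℝ} (hβ : 0 ≤ β) (hx : 0 ≤ x) (hxy : x ≤ y) (hy : y ≤ 1) :
    shade β x ≤ shade β y := by
  rcases le_or_gt 1 (y + √(2 * β * y * (1 - y)) + 4 * β) with h | h
  · rw [shade, shade, min_eq_left h]
    exact min_le_left _ _
  · refine min_le_min_left _ ?_
    have hsy := Real.sqrt_nonneg (2 * β * y * (1 - y))
    have h4 : 4 * β ≤ 1 - y := by linarith
    have hy0 : 0 ≤ y := hx.trans hxy
    have hb : 2 * β * y ≤ √(2 * β * y * (1 - y)) := by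
      refine Real.le_sqrt_of_sq_le ?_
      nlinarith [mul_le_mul_of_nonneg_left h4 (mul_nonneg (mul_nonneg zero_le_two hβ) hy0),
        mul_nonneg (mul_nonneg hβ hβ) (mul_nonneg hy0 (sub_nonneg.2 hy)),
        mul_nonneg (mul_nonneg hβ hβ) hy0]
    have hkey : √(2 * β * x * (1 - x)) ≤ √(2 * β * y * (1 - y)) + (y - x) := by
      refine Real.sqrt_le_iff.2 ⟨by linarith, ?_⟩
      have hsq : √(2 * β * y * (1 - y)) ^ 2 = 2 * β * y * (1 - y) :=
        Real.sq_sqrt (mul_nonneg (by positivity) (by linarith))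
      nlinarith [mul_le_mul_of_nonneg_right hb (sub_nonneg.2 hxy),
        mul_nonneg (mul_nonneg hβ (sub_nonneg.2 hxy)) (sub_nonneg.2 (hxy.trans hy)),
        mul_nonneg (mul_nonneg hβ (sub_nonneg.2 hxy)) hx,
        mul_nonneg (mul_nonneg hβ (sub_nonneg.2 hxy)) hy0, sq_nonneg (y - x)]
    linarith

section empirical

variable {m n : ℕ} (S : Fin m → Fin n → ℝ)

open scoped Classical in
lemma empiricalCDF_eq (i : ℕ) (v : ℝ) :
    empiricalCDF S i v = ((Finset.univ.filter fun t => nthHighest i (S t) < v).card : ℝ) / m := by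
  rw [empiricalCDF, Nat.card_eq_fintype_card, Fintype.card_subtype]

lemma empiricalCDF_nonneg (i : ℕ) (v : ℝ) : 0 ≤ empiricalCDF S i v := by
  rw [empiricalCDF]
  positivity

lemma empiricalCDF_le_one (i : ℕ) (v : ℝ) : empiricalCDF S i v ≤ 1 := by
  classical
  rw [empiricalCDF_eq]
  refine div_le_one_of_le₀ ?_ (Nat.cast_nonneg _)
  exact_mod_cast (Finset.card_le_univ _).trans (Fintype.card_fin m).le

lemma empiricalCDF_le_of_imp {i i' : ℕ} {v v' : ℝ}
    (h : ∀ t, nthHighest i (S t) < v → nthHighest i' (S t) < v') :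
    empiricalCDF S i v ≤ empiricalCDF S i' v' := by
  classical
  rw [empiricalCDF_eq, empiricalCDF_eq]
  refine div_le_div_of_nonneg_right ?_ (Nat.cast_nonneg _)
  exact_mod_cast Finset.card_le_card (Finset.monotone_filter_right _ fun t _ => h t)

lemma empiricalCDF_eq_one (hm : 1 ≤ m) {i : ℕ} {v : ℝ} (h : ∀ t, nthHighest i (S t) < v) :
    empiricalCDF S i v = 1 := by
  classical
  rw [empiricalCDF_eq, Finset.filter_true_of_mem fun t _ => h t, Finset.card_univ,
    Fintype.card_fin, div_self]
  positivity

lemma beta_nonneg {δ : ℝ} (hm : 1 ≤ m) (hδ : 0 < δ) (hδ1 : δ < 1) : 0 ≤ beta m δ := by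
  refine div_nonneg (Real.log_nonneg ?_) (Nat.cast_nonneg _)
  rw [le_div_iff₀ hδ]
  have : (1 : ℝ) ≤ m := by exact_mod_cast hm
  linarith

lemma shadedEmpiricalCDF_le_of_imp {δ : ℝ} (hβ : 0 ≤ beta m δ) {i i' : ℕ} {v v' : ℝ}
    (h : ∀ t, nthHighest i (S t) < v → nthHighest i' (S t) < v') :
    shadedEmpiricalCDF δ S i v ≤ shadedEmpiricalCDF δ S i' v' :=
  shade_mono hβ (empiricalCDF_nonneg S i v) (empiricalCDF_le_of_imp S h)
    (empiricalCDF_le_one S i' v')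

lemma shadedEmpiricalCDF_eq_one {δ : ℝ} (hβ : 0 ≤ beta m δ) (hm : 1 ≤ m) {i : ℕ} {v : ℝ}
    (h : ∀ t, nthHighest i (S t) < v) : shadedEmpiricalCDF δ S i v = 1 := by
  rw [shadedEmpiricalCDF, empiricalCDF_eq_one S hm h, shade_one hβ]

/-- Raising the reserve across an interval where the highest value has no mass gains `(r' - r)(1 -
F₁ r')` in the first term, at least what the tail integral loses. -/
lemma cdfRevenue_le_of_const {r r' : ℝ} (hr : 0 ≤ r) (hrr : r ≤ r') {F₁ F₂ : ℝ → ℝ}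
    (h1 : F₁ r' ≤ F₁ r) (h2 : ∀ x ∈ Ioc r r', F₁ r' ≤ F₂ x) (hF : F₁ r' ≤ 1) :
    cdfRevenue r F₁ F₂ ≤ cdfRevenue r' F₁ F₂ := by
  have hsplit : ∫⁻ x in Ioi r, ENNReal.ofReal (1 - F₂ x) ≤
      ENNReal.ofReal ((r' - r) * (1 - F₁ r')) + ∫⁻ x in Ioi r', ENNReal.ofReal (1 - F₂ x) := by
    rw [← Ioc_union_Ioi_eq_Ioi hrr]
    refine (lintegral_union_le _ _ _).trans (add_le_add_left ?_ _)
    refine (setLIntegral_mono' (g := fun _ => ENNReal.ofReal (1 - F₁ r')) measurableSet_Ioc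
      fun x hx => ENNReal.ofReal_le_ofReal (by linarith [h2 x hx])).trans ?_
    rw [setLIntegral_const, Real.volume_Ioc, mul_comm, ENNReal.ofReal_mul (by linarith)]
  calc cdfRevenue r F₁ F₂
      ≤ ENNReal.ofReal (r * (1 - F₁ r')) + (ENNReal.ofReal ((r' - r) * (1 - F₁ r')) +
          ∫⁻ x in Ioi r', ENNReal.ofReal (1 - F₂ x)) := by
        refine add_le_add (ENNReal.ofReal_le_ofReal ?_) hsplit
        exact mul_le_mul_of_nonneg_left (by linarith) hr
    _ = cdfRevenue r' F₁ F₂ := by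
        rw [← add_assoc, ← ENNReal.ofReal_add (mul_nonneg hr (by linarith))
          (mul_nonneg (by linarith) (by linarith)), cdfRevenue]
        congr 2
        ring

/-- A finite set of candidates suffices: any reserve can be raised to the next sampled highest value
without losing shaded revenue, and beyond all of them that revenue is `0`. -/
lemma exists_isAlgorithmOutput {δ : ℝ} (hm : 1 ≤ m) (hδ : 0 < δ) (hδ1 : δ < 1) :
    ∃ r, IsAlgorithmOutput δ S r := by
  classical
  have hβ := beta_nonneg hm hδ hδ1
  set g : ℝ → ℝ≥0∞ := fun r =>
    cdfRevenue r (shadedEmpiricalCDF δ S 0) (shadedEmpiricalCDF δ S 1) with hg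
  -- The matrix `S` is arbitrary here and may have negative entries, hence the clipping at `0`.
  set T : Finset ℝ := insert 0 (Finset.univ.image fun t => max 0 (nthHighest 0 (S t))) with hT
  obtain ⟨r, hrT, hr⟩ := T.exists_max_image g ⟨0, Finset.mem_insert_self _ _⟩
  have hT0 : ∀ x ∈ T, 0 ≤ x := by
    intro x hx
    rcases Finset.mem_insert.1 hx with rfl | hx
    · exact le_rfl
    · obtain ⟨t, _, rfl⟩ := Finset.mem_image.1 hx
      exact le_max_left _ _
  refine ⟨r, hT0 r hrT, fun r' hr' => ?_⟩
  rcases (T.filter (r' ≤ ·)).eq_empty_or_nonempty with he | hne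
  · have hlt : ∀ t, nthHighest 0 (S t) < r' := by
      intro t
      by_contra hle
      have hmem : max 0 (nthHighest 0 (S t)) ∈ T.filter (r' ≤ ·) :=
        Finset.mem_filter.2 ⟨Finset.mem_insert_of_mem
          (Finset.mem_image_of_mem _ (Finset.mem_univ t)), (not_lt.1 hle).trans (le_max_right _ _)⟩
      rw [he] at hmem
      exact Finset.notMem_empty _ hmem
    have hzero : cdfRevenue r' (shadedEmpiricalCDF δ S 0) (shadedEmpiricalCDF δ S 1) = 0 := by
      rw [cdfRevenue, shadedEmpiricalCDF_eq_one S hβ hm hlt, setLIntegral_congr_fun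
        (g := fun _ => 0) measurableSet_Ioi fun x hx => ?_]
      · simp
      · have hx' : r' < x := hx
        simp only
        rw [shadedEmpiricalCDF_eq_one S hβ hm fun t => ?_, sub_self, ENNReal.ofReal_zero]
        by_contra hle
        exact hle.elim ((lt_or_ge _ _).resolve_right fun h =>
          absurd (le_highest_of_le_secondHighest (hr'.trans_lt hx') h)
            (not_le.2 ((hlt t).trans hx')))
    rw [hzero]
    exact zero_le
  · obtain ⟨r'', hmem, hmin⟩ := (T.filter (r' ≤ ·)).exists_min_image id hne
    obtain ⟨hr''T, hle⟩ := Finset.mem_filter.1 hmem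
    have hgap : ∀ t, nthHighest 0 (S t) < r'' → nthHighest 0 (S t) < r' := by
      intro t ht
      by_contra hcon
      rw [not_lt] at hcon
      have h1 : r'' ≤ max 0 (nthHighest 0 (S t)) := hmin _ (Finset.mem_filter.2
        ⟨Finset.mem_insert_of_mem (Finset.mem_image_of_mem _ (Finset.mem_univ t)),
          hcon.trans (le_max_right _ _)⟩)
      rw [max_eq_right (hr'.trans hcon)] at h1
      linarith
    refine (cdfRevenue_le_of_const hr' hle (shadedEmpiricalCDF_le_of_imp S hβ hgap)
      (fun x hx => shadedEmpiricalCDF_le_of_imp S hβ fun t ht => ?_) (shade_le_one _ _)).trans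
      (hr r'' hr''T)
    by_contra hcon
    have hx0 : 0 < x := hr'.trans_lt hx.1
    have := le_highest_of_le_secondHighest hx0 (not_lt.1 hcon)
    have h2 := hgap t ht
    linarith [hx.1]

end empirical

/-! ### Bernstein's inequality for empirical frequencies -/

lemma two_mul_three_pow_le_factorial (k : ℕ) : 2 * 3 ^ k ≤ (k + 2).factorial := by
  induction k with
  | zero => simp [Nat.factorial]
  | succ k ih =>
    rw [show k + 1 + 2 = (k + 2) + 1 from rfl, Nat.factorial_succ, pow_succ]
    nlinarith

/-- Bernstein's moment bound: from the quadratic term on, the exponential series is dominated by a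
geometric one because `(k + 2)! ≥ 2 * 3 ^ k`. -/
lemma exp_mul_le_of_abs_le_one {l y : ℝ} (hl : 0 ≤ l) (hl3 : l < 3) (hy : |y| ≤ 1) :
    Real.exp (l * y) ≤ 1 + l * y + y ^ 2 * (l ^ 2 / (2 * (1 - l / 3))) := by
  have h1 : HasSum (fun k : ℕ => (l * y) ^ (k + 2) / (k + 2).factorial)
      (Real.exp (l * y) - ∑ k ∈ Finset.range 2, (l * y) ^ k / k.factorial) := by
    refine (hasSum_nat_add_iff' (f := fun k : ℕ => (l * y) ^ k / (k.factorial : ℝ)) 2).2 ?_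
    rw [Real.exp_eq_exp_ℝ]
    exact NormedSpace.expSeries_div_hasSum_exp (l * y)
  have h2 : HasSum (fun k : ℕ => y ^ 2 * (l ^ 2 / 2) * (l / 3) ^ k)
      (y ^ 2 * (l ^ 2 / 2) * (1 - l / 3)⁻¹) :=
    (hasSum_geometric_of_lt_one (by positivity) (by linarith)).mul_left _
  have h3 := hasSum_le (fun k => ?_) h1 h2
  · simp only [Finset.sum_range_succ, Finset.sum_range_zero, pow_zero, Nat.factorial_zero,
      Nat.cast_one, pow_one, Nat.factorial_one] at h3
    have h4 : y ^ 2 * (l ^ 2 / (2 * (1 - l / 3))) = y ^ 2 * (l ^ 2 / 2) * (1 - l / 3)⁻¹ := by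
      rw [div_mul_eq_div_div, div_eq_mul_inv _ (1 - l / 3), mul_assoc]
    linarith
  · have hfac : (2 * 3 ^ k : ℝ) ≤ ((k + 2).factorial : ℝ) := by
      exact_mod_cast two_mul_three_pow_le_factorial k
    have hyk : y ^ (k + 2) ≤ y ^ 2 := by
      refine (le_abs_self _).trans ?_
      rw [abs_pow, pow_add, sq_abs]
      exact mul_le_of_le_one_left (sq_nonneg y) (pow_le_one₀ (abs_nonneg y) hy)
    calc (l * y) ^ (k + 2) / (k + 2).factorial
        ≤ (l ^ (k + 2) * y ^ 2) / (k + 2).factorial := by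
          rw [mul_pow]
          gcongr
      _ ≤ (l ^ (k + 2) * y ^ 2) / (2 * 3 ^ k) := by gcongr
      _ = y ^ 2 * (l ^ 2 / 2) * (l / 3) ^ k := by
          rw [div_pow, pow_add]
          field_simp

section freq

variable {Ω : Type*}

open scoped Classical in
/-- The fraction of the sample points that fall into the set `B`. -/
noncomputable def freq {m : ℕ} (B : Set Ω) (S : Fin m → Ω) : ℝ :=
  ((Finset.univ.filter fun t => S t ∈ B).card : ℝ) / m

lemma freq_eq_sum {m : ℕ} (B : Set Ω) (S : Fin m → Ω) :
    freq B S = (∑ t, B.indicator (fun _ => (1 : ℝ)) (S t)) / m := by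
  classical
  rw [freq, Finset.card_filter]
  push_cast
  simp only [indicator_apply]

lemma freq_nonneg {m : ℕ} (B : Set Ω) (S : Fin m → Ω) : 0 ≤ freq B S := by
  rw [freq]
  positivity

lemma freq_le_one {m : ℕ} (B : Set Ω) (S : Fin m → Ω) : freq B S ≤ 1 := by
  classical
  refine div_le_one_of_le₀ ?_ (Nat.cast_nonneg _)
  exact_mod_cast (Finset.card_le_univ _).trans (Fintype.card_fin m).le

lemma freq_mono {m : ℕ} {B B' : Set Ω} (h : B ⊆ B') (S : Fin m → Ω) : freq B S ≤ freq B' S := by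
  classical
  refine div_le_div_of_nonneg_right ?_ (Nat.cast_nonneg _)
  exact_mod_cast Finset.card_le_card (Finset.monotone_filter_right _ fun t _ ht => h ht)

lemma freq_compl {m : ℕ} (hm : 1 ≤ m) (B : Set Ω) (S : Fin m → Ω) :
    freq Bᶜ S = 1 - freq B S := by
  have hm' : (m : ℝ) ≠ 0 := by positivity
  rw [freq_eq_sum, freq_eq_sum, eq_sub_iff_add_eq, ← add_div, ← Finset.sum_add_distrib,
    div_eq_one_iff_eq hm', Finset.sum_congr rfl fun t _ => ?_, Finset.sum_const, Finset.card_univ,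
    Fintype.card_fin, nsmul_eq_mul, mul_one]
  by_cases h : S t ∈ B <;> simp [h]

variable [MeasurableSpace Ω]

lemma measurable_freq {m : ℕ} {B : Set Ω} (hB : MeasurableSet B) :
    Measurable (freq B : (Fin m → Ω) → ℝ) := by
  have : (freq B : (Fin m → Ω) → ℝ) = fun S =>
      (∑ t, B.indicator (fun _ => (1 : ℝ)) (S t)) / m := funext fun S => freq_eq_sum B S
  rw [this]
  exact (Finset.measurable_sum _ fun t _ =>
    (measurable_const.indicator hB).comp (measurable_pi_apply t)).div_const _

variable (μ : Measure Ω) [IsProbabilityMeasure μ]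

lemma integral_exp_indicator_le {B : Set Ω} (hB : MeasurableSet B) {l : ℝ} (hl : 0 ≤ l)
    (hl3 : l < 3) :
    ∫ x, Real.exp (l * (B.indicator (fun _ => (1 : ℝ)) x - μ.real B)) ∂μ ≤
      Real.exp (l ^ 2 / (2 * (1 - l / 3)) * (μ.real B * (1 - μ.real B))) := by
  set p := μ.real B with hp
  set K := l ^ 2 / (2 * (1 - l / 3))
  have hp0 : 0 ≤ p := measureReal_nonneg
  have hp1 : p ≤ 1 := measureReal_le_one
  have hpt : ∀ x, Real.exp (l * (B.indicator (fun _ => (1 : ℝ)) x - p)) =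
      Real.exp (l * (0 - p)) +
        B.indicator (fun _ => Real.exp (l * (1 - p)) - Real.exp (l * (0 - p))) x := by
    intro x
    by_cases h : x ∈ B <;> simp [h]
  simp_rw [hpt]
  rw [integral_add (integrable_const _) ((integrable_const _).indicator hB), integral_const,
    integral_indicator_const _ hB, probReal_univ, smul_eq_mul, smul_eq_mul, ← hp]
  have h0 := exp_mul_le_of_abs_le_one hl hl3 (y := 0 - p) (by rw [abs_le]; constructor <;> linarith)
  have h1 := exp_mul_le_of_abs_le_one hl hl3 (y := 1 - p) (by rw [abs_le]; constructor <;> linarith)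
  have h2 := Real.add_one_le_exp (K * (p * (1 - p)))
  have h3 := mul_le_mul_of_nonneg_left h0 (sub_nonneg.2 hp1)
  have h4 := mul_le_mul_of_nonneg_left h1 hp0
  refine le_trans ?_ h2
  linear_combination h3 + h4

/-- Chernoff's method. The term `d / 2`, weaker than the classical `d / 3`, is enough here and makes
the deviation below a simple quadratic root. -/
lemma measureReal_freq_ge_le {m : ℕ} (hm : 1 ≤ m) {B : Set Ω} (hB : MeasurableSet B) {d : ℝ}
    (hd : 0 < d) :
    (Measure.pi fun _ : Fin m => μ).real {S | μ.real B + d ≤ freq B S} ≤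
      Real.exp (-(m * (d ^ 2 / (2 * (μ.real B * (1 - μ.real B) + d / 2))))) := by
  set p := μ.real B with hp
  have hp0 : 0 ≤ p := measureReal_nonneg
  have hp1 : p ≤ 1 := measureReal_le_one
  set V := p * (1 - p) + d / 2 with hV
  have hσ : 0 ≤ p * (1 - p) := mul_nonneg hp0 (sub_nonneg.2 hp1)
  have hVpos : 0 < V := by positivity
  -- With this exponent the moment bound costs at most `l * d / 2` per sample, half of the gain `l *
  -- d`.
  set l := d / V with hl
  have hl0 : 0 ≤ l := by positivity
  have hlV : l * V = d := div_mul_cancel₀ d hVpos.ne'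
  have hl2 : l ≤ 2 := by
    rw [hl, div_le_iff₀ hVpos]
    linarith
  set P := Measure.pi fun _ : Fin m => μ
  set X : (Fin m → Ω) → ℝ := fun S => ∑ t, (B.indicator (fun _ => (1 : ℝ)) (S t) - p) with hX
  have hm0 : (0 : ℝ) < m := by positivity
  have hset : {S : Fin m → Ω | p + d ≤ freq B S} = {S | m * d ≤ X S} := by
    ext S
    change p + d ≤ freq B S ↔ m * d ≤ X S
    rw [freq_eq_sum, le_div_iff₀ hm0, hX]
    simp only [Finset.sum_sub_distrib, Finset.sum_const, Finset.card_univ, Fintype.card_fin,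
      nsmul_eq_mul]
    constructor <;> intro h <;> linarith
  have hprod : ∀ S : Fin m → Ω, Real.exp (l * X S) =
      ∏ t, Real.exp (l * (B.indicator (fun _ => (1 : ℝ)) (S t) - p)) := by
    intro S
    rw [← Real.exp_sum, hX, Finset.mul_sum]
  have hmX : Measurable X := Finset.measurable_sum _ fun t _ =>
    ((measurable_const.indicator hB).comp (measurable_pi_apply t)).sub_const _
  have hint : Integrable (fun S => Real.exp (l * X S)) P := by
    refine Integrable.of_bound (C := Real.exp (l * m))
      (hmX.const_mul l).exp.aestronglyMeasurable (Filter.Eventually.of_forall fun S => ?_)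
    rw [Real.norm_eq_abs, abs_of_pos (Real.exp_pos _)]
    refine Real.exp_le_exp.2 (mul_le_mul_of_nonneg_left ?_ hl0)
    calc X S ≤ ∑ _t : Fin m, (1 : ℝ) := Finset.sum_le_sum fun t _ => by
          have : B.indicator (fun _ => (1 : ℝ)) (S t) ≤ 1 :=
            indicator_le_self' (fun _ _ => zero_le_one) _
          linarith
      _ = m := by simp
  rw [hset]
  refine (ProbabilityTheory.measure_ge_le_exp_mul_mgf _ hl0 hint).trans ?_
  rw [ProbabilityTheory.mgf]
  simp_rw [hprod]
  rw [integral_fintype_prod_eq_pow (fun x => Real.exp (l * (B.indicator (fun _ => (1 : ℝ)) x - p))),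
    Fintype.card_fin]
  have hmgf := integral_exp_indicator_le μ hB hl0 (by linarith : l < 3)
  rw [← hp] at hmgf
  have hK : l ^ 2 / (2 * (1 - l / 3)) * (p * (1 - p)) ≤ l * d / 2 := by
    rw [div_mul_eq_mul_div, div_le_iff₀ (by linarith)]
    have : l * d / 2 * (2 * (1 - l / 3)) = l ^ 2 * (p * (1 - p)) + l ^ 2 * d / 6 := by
      have hlV' : l * (p * (1 - p) + d / 2) = d := hlV
      linear_combination (-l) * hlV'
    rw [this]
    have : 0 ≤ l ^ 2 * d / 6 := by positivity
    linarith
  calc Real.exp (-l * (m * d)) *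
        (∫ x, Real.exp (l * (B.indicator (fun _ => (1 : ℝ)) x - p)) ∂μ) ^ m
      ≤ Real.exp (-l * (m * d)) * Real.exp (l * d / 2) ^ m := by
        refine mul_le_mul_of_nonneg_left ?_ (Real.exp_pos _).le
        exact pow_le_pow_left₀ (integral_nonneg fun x => (Real.exp_pos _).le)
          (hmgf.trans (Real.exp_le_exp.2 hK)) m
    _ = Real.exp (-(m * (d ^ 2 / (2 * V)))) := by
        rw [← Real.exp_nat_mul, ← Real.exp_add]
        congr 1
        rw [hl]
        field_simp
        ring

/-- The deviation of a frequency with variance `v` that has probability at most `exp (- β m)`. -/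
noncomputable def deviation (β v : ℝ) : ℝ := β / 2 + √(β ^ 2 / 4 + 2 * β * v)

lemma deviation_pos {β : ℝ} (hβ : 0 < β) (v : ℝ) : 0 < deviation β v := by
  rw [deviation]
  positivity

/-- This quadratic equation makes the exponent in Bernstein's bound equal to `-(β * m)`. -/
lemma deviation_sq {β v : ℝ} (hβ : 0 ≤ β) (hv : 0 ≤ v) :
    deviation β v ^ 2 = 2 * β * (v + deviation β v / 2) := by
  have h : √(β ^ 2 / 4 + 2 * β * v) ^ 2 = β ^ 2 / 4 + 2 * β * v := Real.sq_sqrt (by positivity)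
  rw [deviation]
  linear_combination h

lemma measureReal_freq_ge_deviation_le {m : ℕ} (hm : 1 ≤ m) {B : Set Ω} (hB : MeasurableSet B)
    {β : ℝ} (hβ : 0 < β) :
    (Measure.pi fun _ : Fin m => μ).real
        {S | μ.real B + deviation β (μ.real B * (1 - μ.real B)) ≤ freq B S} ≤
      Real.exp (-(β * m)) := by
  have hσ : 0 ≤ μ.real B * (1 - μ.real B) :=
    mul_nonneg measureReal_nonneg (sub_nonneg.2 measureReal_le_one)
  have hd := deviation_pos hβ (μ.real B * (1 - μ.real B))
  refine (measureReal_freq_ge_le μ hm hB hd).trans (Real.exp_le_exp.2 ?_)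
  rw [deviation_sq hβ.le hσ]
  have : μ.real B * (1 - μ.real B) + deviation β (μ.real B * (1 - μ.real B)) / 2 ≠ 0 := by
    positivity
  rw [neg_le_neg_iff, mul_div_mul_comm, div_self this, mul_div_cancel_left₀ β two_ne_zero, mul_one,
    mul_comm]

lemma measureReal_freq_le_deviation_le {m : ℕ} (hm : 1 ≤ m) {B : Set Ω} (hB : MeasurableSet B)
    {β : ℝ} (hβ : 0 < β) :
    (Measure.pi fun _ : Fin m => μ).real
        {S | freq B S ≤ μ.real B - deviation β (μ.real B * (1 - μ.real B))} ≤
      Real.exp (-(β * m)) := by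
  have h := measureReal_freq_ge_deviation_le μ hm hB.compl hβ
  rw [probReal_compl_eq_one_sub hB] at h
  refine le_trans (le_of_eq ?_) h
  congr 1
  ext S
  change freq B S ≤ _ ↔ _ ≤ freq Bᶜ S
  rw [freq_compl hm, sub_sub_cancel, mul_comm (1 - μ.real B)]
  constructor <;> intro h <;> linarith

end freq

/-! ### Quantiles -/

lemma leftCDF_nonneg (ν : Measure ℝ) (v : ℝ) : 0 ≤ leftCDF ν v := measureReal_nonneg

section leftCDF

variable (ν : Measure ℝ) [IsProbabilityMeasure ν]

lemma leftCDF_mono : Monotone (leftCDF ν) := fun _ _ h => measureReal_mono (Iio_subset_Iio h)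

lemma leftCDF_le_one (v : ℝ) : leftCDF ν v ≤ 1 := measureReal_le_one

lemma one_sub_leftCDF (v : ℝ) : 1 - leftCDF ν v = ν.real (Ici v) := by
  rw [← compl_Iio, probReal_compl_eq_one_sub measurableSet_Iio, leftCDF]

lemma leftCDF_le_of_forall_lt {v a : ℝ} (h : ∀ u < v, leftCDF ν u ≤ a) : leftCDF ν v ≤ a := by
  obtain ⟨u, hu, huv, hlim⟩ := exists_seq_strictMono_tendsto v
  have hU : ⋃ k, Iio (u k) = Iio v := by
    refine subset_antisymm (iUnion_subset fun k => Iio_subset_Iio (huv k).le) fun x hx => ?_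
    obtain ⟨k, hk⟩ := (hlim.eventually (lt_mem_nhds (mem_Iio.1 hx))).exists
    exact mem_iUnion.2 ⟨k, hk⟩
  have ht := tendsto_measure_iUnion_atTop (μ := ν) (s := fun k => Iio (u k))
    fun i j hij => Iio_subset_Iio (hu.monotone hij)
  rw [hU] at ht
  have ht' := (ENNReal.tendsto_toReal (measure_ne_top ν (Iio v))).comp ht
  exact le_of_tendsto' ht' fun k => h (u k) (huv k)

lemma le_measureReal_Iic_of_forall_lt {v a : ℝ} (h : ∀ w > v, a ≤ leftCDF ν w) :
    a ≤ ν.real (Iic v) := by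
  rw [← ProbabilityTheory.cdf_eq_real]
  refine ge_of_tendsto (((ProbabilityTheory.cdf ν).right_continuous v).mono_left
    (nhdsWithin_mono _ Ioi_subset_Ici_self)) ?_
  filter_upwards [self_mem_nhdsWithin] with w hw
  rw [ProbabilityTheory.cdf_eq_real]
  exact (h w hw).trans (measureReal_mono Iio_subset_Iic_self)

lemma tendsto_leftCDF_atTop : Filter.Tendsto (leftCDF ν) Filter.atTop (nhds 1) := by
  refine tendsto_of_tendsto_of_tendsto_of_le_of_le
    ((ProbabilityTheory.tendsto_cdf_atTop ν).comp
      (Filter.tendsto_atTop_add_const_right _ (-1 : ℝ) Filter.tendsto_id))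
    tendsto_const_nhds (fun v => ?_) (leftCDF_le_one ν)
  simp only [Function.comp_apply, id]
  rw [ProbabilityTheory.cdf_eq_real]
  exact measureReal_mono (Iic_subset_Iio.2 (by linarith))

lemma exists_quantile (h0 : ν (Iio 0) = 0) {a : ℝ} (ha : 0 ≤ a) (ha1 : a < 1) :
    ∃ v, 0 ≤ v ∧ leftCDF ν v ≤ a ∧ ∀ w > v, a < leftCDF ν w := by
  have hz : leftCDF ν 0 ≤ a := by
    rw [leftCDF, measureReal_def, h0]
    simpa using ha
  obtain ⟨b, hb⟩ := ((tendsto_leftCDF_atTop ν).eventually (lt_mem_nhds ha1)).exists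
  have hbdd : BddAbove {v | leftCDF ν v ≤ a} := ⟨b, fun v hv => by
    by_contra hlt
    exact absurd (leftCDF_mono ν (not_le.1 hlt).le) (not_le.2 (lt_of_le_of_lt hv hb))⟩
  refine ⟨sSup {v | leftCDF ν v ≤ a}, le_csSup hbdd hz, ?_, fun w hw => ?_⟩
  · refine leftCDF_le_of_forall_lt ν fun u hu => ?_
    obtain ⟨s, hs, hus⟩ := exists_lt_of_lt_csSup ⟨0, hz⟩ hu
    exact (leftCDF_mono ν hus.le).trans hs
  · by_contra hle
    exact absurd (le_csSup hbdd (show w ∈ {v | leftCDF ν v ≤ a} from not_lt.1 hle)) (not_le.2 hw)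

end leftCDF

/-! ### Uniform concentration of the shaded empirical distribution -/

/-- Inverts Bernstein, replacing the unknown variance by the empirical one. When `x < p`, the two
inequalities `(p - x)² ≤ 2βp(1 - p) + β(p - x)` and `p(1 - p) ≤ x(1 - x) + (p - x)` give `p - x ≤
√(2βx(1 - x)) + 3β`. One more `β` pays for the step from `F` to `p`, which explains the `4β` in the
shading. -/
lemma le_shade_of_sub_deviation_lt {β p x y F : ℝ} (hβ : 0 < β) (hp0 : 0 ≤ p) (hp1 : p ≤ 1)
    (hx0 : 0 ≤ x) (hxy : x ≤ y) (hy1 : y ≤ 1) (hx : p - deviation β (p * (1 - p)) < x)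
    (hF : F ≤ p + β) (hF1 : F ≤ 1) : F ≤ shade β y := by
  refine le_trans (le_min hF1 ?_) (shade_mono hβ.le hx0 hxy hy1)
  have hs := Real.sqrt_nonneg (2 * β * x * (1 - x))
  rcases le_or_gt p x with h | h
  · linarith
  have hσ : 0 ≤ p * (1 - p) := mul_nonneg hp0 (sub_nonneg.2 hp1)
  have hD := deviation_sq hβ.le hσ
  have hDpos := deviation_pos hβ (p * (1 - p))
  set D := deviation β (p * (1 - p))
  have hsq : √(2 * β * x * (1 - x)) ^ 2 = 2 * β * x * (1 - x) :=
    Real.sq_sqrt (mul_nonneg (by positivity) (by linarith))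
  set s := √(2 * β * x * (1 - x))
  have h1 : (p - x) ^ 2 ≤ 2 * β * (p * (1 - p)) + β * (p - x) := by
    by_contra hcon
    rw [not_le] at hcon
    have hDβ : β * D ≤ D ^ 2 := by nlinarith
    have : 0 ≤ (D - (p - x)) * (D + (p - x) - β) := by
      refine mul_nonneg (by linarith) ?_
      have : β ≤ D := by nlinarith
      linarith
    nlinarith
  have h2 : p * (1 - p) ≤ x * (1 - x) + (p - x) := by nlinarith
  by_contra hcon
  rw [not_le] at hcon
  have h3 : s + 3 * β < p - x := by linarith
  nlinarith [mul_le_mul_of_nonneg_left h2 hβ.le,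
    mul_lt_mul'' h3 (by linarith : s < p - x - 3 * β) (by positivity) hs]

/-- The deviation and the shading each contribute `3/2 * √(β(1 - F))`, using `√2 ≤ 3/2`. The `6β`
consists of `β` for the grid, `β` for the deviation and `4β` for the shading. -/
lemma shade_le_of_lt_add_deviation {β p x y F : ℝ} (hβ : 0 < β) (hp0 : 0 ≤ p) (hp1 : p ≤ 1)
    (hx0 : 0 ≤ x) (hxy : x ≤ y) (hy1 : y ≤ 1) (hy : y < p + deviation β (p * (1 - p)))
    (hFp : F ≤ p) (hpF : p ≤ F + β) : shade β x ≤ F + 3 * √(β * (1 - F)) + 6 * β := by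
  have hσ : 0 ≤ p * (1 - p) := mul_nonneg hp0 (sub_nonneg.2 hp1)
  have hq : p * (1 - p) ≤ 1 - F := by nlinarith
  have hq0 : 0 ≤ 1 - F := by linarith
  set s := √(β * (1 - F)) with hs
  have hs0 : 0 ≤ s := Real.sqrt_nonneg _
  have hsq : s ^ 2 = β * (1 - F) := Real.sq_sqrt (by positivity)
  have h2s : ∀ z, 0 ≤ z → z ≤ 1 - F → √(2 * β * z) ≤ 3 / 2 * s := by
    intro z hz hz1
    refine Real.sqrt_le_iff.2 ⟨by positivity, ?_⟩
    have := mul_le_mul_of_nonneg_left hz1 hβ.le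
    nlinarith [mul_nonneg hβ.le hq0]
  have hdev : deviation β (p * (1 - p)) ≤ β + 3 / 2 * s := by
    rw [deviation]
    have : √(β ^ 2 / 4 + 2 * β * (p * (1 - p))) ≤ β / 2 + 3 / 2 * s := by
      refine Real.sqrt_le_iff.2 ⟨by positivity, ?_⟩
      have := mul_le_mul_of_nonneg_left hq hβ.le
      nlinarith [mul_nonneg hβ.le hq0, mul_nonneg hβ.le hs0]
    linarith
  -- Monotonicity of the shading allows moving up to `y' ≥ p`, where `1 - y' ≤ 1 - F` bounds the
  -- variance.
  set y' := min 1 (p + deviation β (p * (1 - p))) with hy'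
  have hdpos := deviation_pos hβ (p * (1 - p))
  have hpy : p ≤ y' := le_min hp1 (by linarith)
  have hyy : y ≤ y' := le_min hy1 hy.le
  have h1 : shade β x ≤ shade β y' :=
    shade_mono hβ.le hx0 (hxy.trans hyy) (min_le_left _ _)
  have h2 : shade β y' ≤ y' + √(2 * β * y' * (1 - y')) + 4 * β := min_le_right _ _
  have hy1' : y' ≤ 1 := min_le_left _ _
  have h3 : √(2 * β * y' * (1 - y')) ≤ 3 / 2 * s := by
    rw [mul_assoc]
    refine h2s _ (mul_nonneg (hp0.trans hpy) (by linarith)) ?_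
    nlinarith
  have h4 : y' ≤ p + deviation β (p * (1 - p)) := min_le_right _ _
  linarith

lemma inv_le_beta {m : ℕ} {δ : ℝ} (hm : 1 ≤ m) (hδ : 0 < δ) (hδ1 : δ < 1) :
    1 / (m : ℝ) ≤ beta m δ := by
  have hm1 : (1 : ℝ) ≤ m := by exact_mod_cast hm
  refine div_le_div_of_nonneg_right ?_ (Nat.cast_nonneg _)
  rw [Real.le_log_iff_exp_le (by positivity), le_div_iff₀ hδ]
  have := Real.exp_one_lt_d9
  nlinarith [Real.exp_pos 1]

lemma exp_neg_beta_mul {m : ℕ} {δ : ℝ} (hm : 1 ≤ m) (hδ : 0 < δ) :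
    Real.exp (-(beta m δ * m)) = δ / (8 * m) := by
  have hm1 : (0 : ℝ) < m := by positivity
  rw [beta, div_mul_cancel₀ _ hm1.ne', Real.exp_neg, Real.exp_log (by positivity), inv_div]

/-- `G` is, uniformly, a pessimistic estimate of the CDF `F` with an error governed by `β`. -/
noncomputable def IsPessimisticEstimate (β : ℝ) (F G : ℝ → ℝ) : Prop :=
  ∀ v, F v ≤ G v ∧ G v ≤ F v + 3 * √(β * (1 - F v)) + 6 * β

/-- Deviations are controlled at the `m` quantiles `k / m` only; between neighbouring ones the CDF
varies by at most `1 / m ≤ β`. Atoms are handled by using `X < q k` for upper deviations and `X ≤ q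
k` for lower ones. The union bound has `2m` events of probability at most `δ / (8m)`. -/
lemma exists_forall_isPessimisticEstimate {Ω : Type*} [MeasurableSpace Ω] (μ : Measure Ω)
    [IsProbabilityMeasure μ] {X : Ω → ℝ} (hX : Measurable X) (hX0 : ∀ᵐ x ∂μ, 0 ≤ X x)
    {m : ℕ} (hm : 1 ≤ m) {δ : ℝ} (hδ : 0 < δ) (hδ1 : δ < 1) :
    ∃ A : Set (Fin m → Ω), MeasurableSet A ∧
      (Measure.pi fun _ : Fin m => μ).real Aᶜ ≤ δ / 2 ∧
      ∀ S ∈ A, IsPessimisticEstimate (beta m δ) (fun v => μ.real {x | X x < v})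
        (fun v => shade (beta m δ) (freq {x | X x < v} S)) := by
  have hm0 : (0 : ℝ) < m := by positivity
  have hβm := inv_le_beta hm hδ hδ1
  have hβ : 0 < beta m δ := lt_of_lt_of_le (by positivity) hβm
  set β := beta m δ with hβdef
  have hν : IsProbabilityMeasure (μ.map X) := Measure.isProbabilityMeasure_map hX.aemeasurable
  have hν0 : (μ.map X) (Iio 0) = 0 := by
    rw [Measure.map_apply hX measurableSet_Iio]
    refine measure_mono_null (fun x hx => ?_) (ae_iff.1 hX0)
    exact not_le.2 hx
  have hF : ∀ v, μ.real {x | X x < v} = leftCDF (μ.map X) v := fun v => by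
    rw [leftCDF, map_measureReal_apply hX measurableSet_Iio]
    rfl
  have hF' : ∀ v, μ.real {x | X x ≤ v} = (μ.map X).real (Iic v) := fun v => by
    rw [map_measureReal_apply hX measurableSet_Iic]
    rfl
  have hq : ∀ k : Fin m, ∃ v, 0 ≤ v ∧ leftCDF (μ.map X) v ≤ (k : ℝ) / m ∧
      ∀ w > v, (k : ℝ) / m < leftCDF (μ.map X) w := fun k => by
    refine exists_quantile _ hν0 (by positivity) ?_
    rw [div_lt_one hm0]
    exact_mod_cast k.2
  choose q _ hq1 hq2 using hq
  have hq3 : ∀ k : Fin m, (k : ℝ) / m ≤ μ.real {x | X x ≤ q k} := fun k => by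
    rw [hF']
    exact le_measureReal_Iic_of_forall_lt _ fun w hw => (hq2 k w hw).le
  have hmlt : ∀ v, MeasurableSet {x | X x < v} := fun v => measurableSet_lt hX measurable_const
  have hmle : ∀ v, MeasurableSet {x | X x ≤ v} := fun v => measurableSet_le hX measurable_const
  set D : Set Ω → ℝ := fun B => deviation β (μ.real B * (1 - μ.real B)) with hD
  set B1 : Fin m → Set (Fin m → Ω) := fun k =>
    {S | μ.real {x | X x < q k} + D {x | X x < q k} ≤ freq {x | X x < q k} S} with hB1
  set B2 : Fin m → Set (Fin m → Ω) := fun k =>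
    {S | freq {x | X x ≤ q k} S ≤ μ.real {x | X x ≤ q k} - D {x | X x ≤ q k}} with hB2
  refine ⟨(⋃ k, (B1 k ∪ B2 k))ᶜ, ?_, ?_, fun S hS v => ?_⟩
  · refine (MeasurableSet.iUnion fun k => MeasurableSet.union ?_ ?_).compl
    · exact measurableSet_le measurable_const (measurable_freq (hmlt _))
    · exact measurableSet_le (measurable_freq (hmle _)) measurable_const
  · rw [compl_compl]
    calc (Measure.pi fun _ : Fin m => μ).real (⋃ k, (B1 k ∪ B2 k))
        ≤ ∑ k, (Measure.pi fun _ : Fin m => μ).real (B1 k ∪ B2 k) := measureReal_iUnion_fintype_le _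
      _ ≤ ∑ _k : Fin m, (δ / (8 * m) + δ / (8 * m)) := by
          refine Finset.sum_le_sum fun k _ => (measureReal_union_le _ _).trans ?_
          rw [← exp_neg_beta_mul hm hδ]
          exact add_le_add (measureReal_freq_ge_deviation_le μ hm (hmlt _) hβ)
            (measureReal_freq_le_deviation_le μ hm (hmle _) hβ)
      _ = δ / 4 := by
          rw [Finset.sum_const, Finset.card_univ, Fintype.card_fin, nsmul_eq_mul]
          field_simp
          norm_num
      _ ≤ δ / 2 := by linarith
  · have hS1 : ∀ k, freq {x | X x < q k} S < μ.real {x | X x < q k} + D {x | X x < q k} := by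
      intro k
      by_contra hle
      exact hS (mem_iUnion.2 ⟨k, Or.inl (not_lt.1 hle)⟩)
    have hS2 : ∀ k, μ.real {x | X x ≤ q k} - D {x | X x ≤ q k} < freq {x | X x ≤ q k} S := by
      intro k
      by_contra hle
      exact hS (mem_iUnion.2 ⟨k, Or.inr (not_lt.1 hle)⟩)
    set F := leftCDF (μ.map X) v with hFv
    have hF0 : 0 ≤ F := leftCDF_nonneg _ v
    have hF1 : F ≤ 1 := leftCDF_le_one _ v
    simp only [hF v]
    constructor
    · rcases hF0.eq_or_lt with h | h
      · rw [← hFv, ← h]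
        refine le_min zero_le_one ?_
        have := freq_nonneg {x | X x < v} S
        positivity
      -- The largest `k` with `k / m < F`; strictness puts `q k` strictly below `v`, so that `X ≤ q
      -- k` implies `X < v`.
      · obtain ⟨k, hk⟩ : ∃ k, ⌈m * F⌉₊ = k + 1 :=
          Nat.exists_eq_succ_of_ne_zero (Nat.ceil_pos.2 (by positivity)).ne'
        have hk1 : (k : ℝ) < m * F := by
          refine Nat.lt_ceil.1 ?_
          omega
        have hk2 : m * F ≤ k + 1 := by
          have := Nat.le_ceil (m * F)
          rw [hk] at this
          exact_mod_cast this
        have hkm : k < m := by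
          have : (k : ℝ) < m := by nlinarith
          exact_mod_cast this
        have hlt : q ⟨k, hkm⟩ < v := by
          by_contra hle
          have h1 := (leftCDF_mono (μ.map X) (not_lt.1 hle)).trans (hq1 ⟨k, hkm⟩)
          rw [← hFv, le_div_iff₀ hm0] at h1
          simp only at h1
          linarith
        have hFk : F ≤ (k : ℝ) / m + 1 / m := by
          rw [← add_div, le_div_iff₀ hm0]
          linarith
        refine le_shade_of_sub_deviation_lt hβ measureReal_nonneg measureReal_le_one
          (freq_nonneg _ S) (freq_mono (fun x hx => lt_of_le_of_lt hx hlt) S) (freq_le_one _ S)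
          (hS2 ⟨k, hkm⟩) ?_ hF1
        have := hq3 ⟨k, hkm⟩
        simp only at this
        linarith
    · have hk1 : (⌊m * F⌋₊ : ℝ) ≤ m * F := Nat.floor_le (by positivity)
      have hk2 : m * F < ⌊m * F⌋₊ + 1 := Nat.lt_floor_add_one _
      set k := ⌊m * F⌋₊
      have hFk : ((k : ℝ) + 1) / m ≤ F + 1 / m := by
        rw [add_div]
        gcongr
        rw [div_le_iff₀ hm0]
        linarith
      rcases lt_or_ge (k + 1) m with hkm | hkm
      · have hvq : v ≤ q ⟨k + 1, hkm⟩ := by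
          by_contra hlt
          have := hq2 ⟨k + 1, hkm⟩ v (not_le.1 hlt)
          rw [← hFv, div_lt_iff₀ hm0] at this
          push_cast at this
          linarith
        have h1 := hq1 ⟨k + 1, hkm⟩
        push_cast at h1
        refine shade_le_of_lt_add_deviation hβ measureReal_nonneg measureReal_le_one
          (freq_nonneg _ S) (freq_mono (fun x hx => lt_of_lt_of_le hx hvq) S) (freq_le_one _ S)
          (hS1 ⟨k + 1, hkm⟩) ?_ ?_
        · rw [hF]
          exact leftCDF_mono _ hvq
        · rw [hF]
          linarith
      -- No grid point is left above `v`, but then `F + β ≥ 1` and the bound is trivial.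
      · have h1 : 1 ≤ ((k : ℝ) + 1) / m := by
          rw [le_div_iff₀ hm0, one_mul]
          exact_mod_cast hkm
        have h2 := Real.sqrt_nonneg (β * (1 - F))
        refine (shade_le_one _ _).trans ?_
        linarith

/-! ### Reduction of the learning guarantee to a bound on the revenue loss -/

/-- The error of a pessimistic estimate at a point where the survival probability is `q`. -/
noncomputable def loss (β q : ℝ) : ℝ := min q (3 * √(β * q) + 6 * β)

/-- The revenue that the reserve `r` may lose when the CDFs are replaced by pessimistic estimates. -/
noncomputable def revenueLoss (β r : ℝ) (F₁ F₂ : ℝ → ℝ) : ℝ≥0∞ :=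
  ENNReal.ofReal (r * loss β (1 - F₁ r)) + ∫⁻ x in Ioi r, ENNReal.ofReal (loss β (1 - F₂ x))

lemma measurable_loss (β : ℝ) : Measurable (loss β) :=
  measurable_id.min (((measurable_id.const_mul β).sqrt.const_mul 3).add_const _)

lemma cdfRevenue_anti {r : ℝ} (hr : 0 ≤ r) {F₁ F₂ G₁ G₂ : ℝ → ℝ} (h1 : ∀ v, F₁ v ≤ G₁ v)
    (h2 : ∀ v, F₂ v ≤ G₂ v) : cdfRevenue r G₁ G₂ ≤ cdfRevenue r F₁ F₂ := by
  refine add_le_add (ENNReal.ofReal_le_ofReal ?_)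
    (lintegral_mono fun x => ENNReal.ofReal_le_ofReal ?_)
  · exact mul_le_mul_of_nonneg_left (by linarith [h1 r]) hr
  · linarith [h2 x]

lemma one_sub_le_add_loss {β : ℝ} {F G : ℝ → ℝ} (h : IsPessimisticEstimate β F G)
    (hG : ∀ v, G v ≤ 1) (v : ℝ) : 1 - F v ≤ (1 - G v) + loss β (1 - F v) := by
  have h1 := (h v).2
  have h2 : (1 - F v) - (1 - G v) ≤ loss β (1 - F v) :=
    le_min (by linarith [hG v]) (by linarith)
  linarith

lemma cdfRevenue_le_add_revenueLoss {β r : ℝ} (hr : 0 ≤ r) {F₁ F₂ G₁ G₂ : ℝ → ℝ}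
    (h1 : IsPessimisticEstimate β F₁ G₁) (h2 : IsPessimisticEstimate β F₂ G₂)
    (hG1 : ∀ v, G₁ v ≤ 1) (hG2 : ∀ v, G₂ v ≤ 1) (hF2 : Measurable F₂) :
    cdfRevenue r F₁ F₂ ≤ cdfRevenue r G₁ G₂ + revenueLoss β r F₁ F₂ := by
  rw [cdfRevenue, cdfRevenue, revenueLoss, add_add_add_comm]
  refine add_le_add ?_ ?_
  · refine le_trans (ENNReal.ofReal_le_ofReal ?_) ENNReal.ofReal_add_le
    rw [← mul_add]
    exact mul_le_mul_of_nonneg_left (one_sub_le_add_loss h1 hG1 r) hr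
  · have hml : Measurable fun x => ENNReal.ofReal (loss β (1 - F₂ x)) :=
      ((measurable_loss β).comp (hF2.const_sub 1)).ennreal_ofReal
    rw [← lintegral_add_right _ hml]
    exact lintegral_mono fun x => (ENNReal.ofReal_le_ofReal (one_sub_le_add_loss h2 hG2 x)).trans
      ENNReal.ofReal_add_le

lemma empiricalCDF_eq_freq {m n : ℕ} (S : Fin m → Fin n → ℝ) (i : ℕ) (v : ℝ) :
    empiricalCDF S i v = freq {s | nthHighest i s < v} S := by
  classical
  rw [empiricalCDF_eq, freq]
  rfl

/-- The loss appears at the comparison reserve `r` and not at the output `r'`, because the shaded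
revenue of `r'` never exceeds its true revenue. -/
theorem learnsReserve_of_revenueLoss {n : ℕ} (μ : Measure (Fin n → ℝ)) [IsProbabilityMeasure μ]
    (hμ : ∀ᵐ s ∂μ, ∀ j, 0 ≤ s j) {m : ℕ} (hm : 1 ≤ m) {δ : ℝ} (hδ : 0 < δ) (hδ1 : δ < 1)
    {good : ℝ → Prop}
    (h : ∀ r', 0 ≤ r' → (∀ r, 0 ≤ r → expectedRevenue r μ ≤
      expectedRevenue r' μ + revenueLoss (beta m δ) r (orderCDF μ 0) (orderCDF μ 1)) → good r') :
    LearnsReserve μ m δ good := by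
  have hX0 : ∀ i, ∀ᵐ s ∂μ, 0 ≤ nthHighest i s := fun i => by
    filter_upwards [hμ] with s hs
    exact nthHighest_nonneg i hs
  obtain ⟨A0, hA0, hP0, hE0⟩ := exists_forall_isPessimisticEstimate μ
    (measurable_nthHighest 0) (hX0 0) hm hδ hδ1
  obtain ⟨A1, hA1, hP1, hE1⟩ := exists_forall_isPessimisticEstimate μ
    (measurable_nthHighest 1) (hX0 1) hm hδ hδ1
  refine ⟨A0 ∩ A1, hA0.inter hA1, ?_, fun S hS =>
    ⟨exists_isAlgorithmOutput S hm hδ hδ1, fun r' hr' => h r' hr'.1 fun r hr => ?_⟩⟩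
  · rw [← ofReal_measureReal]
    refine ENNReal.ofReal_le_ofReal ?_
    have h1 := probReal_compl_eq_one_sub (μ := Measure.pi fun _ : Fin m => μ) (hA0.inter hA1)
    rw [compl_inter] at h1
    have h2 := measureReal_union_le (μ := Measure.pi fun _ : Fin m => μ) A0ᶜ A1ᶜ
    linarith
  · have hest : ∀ i, IsPessimisticEstimate (beta m δ) (orderCDF μ i)
        (fun v => shade (beta m δ) (freq {s | nthHighest i s < v} S)) →
        IsPessimisticEstimate (beta m δ) (orderCDF μ i) (shadedEmpiricalCDF δ S i) := by
      intro i hi v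
      rw [shadedEmpiricalCDF, empiricalCDF_eq_freq]
      exact hi v
    have h0 := hest 0 (hE0 S hS.1)
    have h1 := hest 1 (hE1 S hS.2)
    rw [expectedRevenue_eq_cdfRevenue μ hμ hr, expectedRevenue_eq_cdfRevenue μ hμ hr'.1]
    calc cdfRevenue r (orderCDF μ 0) (orderCDF μ 1)
        ≤ cdfRevenue r (shadedEmpiricalCDF δ S 0) (shadedEmpiricalCDF δ S 1) +
            revenueLoss (beta m δ) r (orderCDF μ 0) (orderCDF μ 1) :=
          cdfRevenue_le_add_revenueLoss hr h0 h1 (fun v => shade_le_one _ _)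
            (fun v => shade_le_one _ _) (measurable_orderCDF μ 1)
      _ ≤ cdfRevenue r' (shadedEmpiricalCDF δ S 0) (shadedEmpiricalCDF δ S 1) +
            revenueLoss (beta m δ) r (orderCDF μ 0) (orderCDF μ 1) :=
          add_le_add_left (hr'.2 r hr) _
      _ ≤ _ := add_le_add_left (cdfRevenue_anti hr'.1 (fun v => (h0 v).1) fun v => (h1 v).1) _

/-! ### Estimates of `beta` and of the loss -/

/-- Removes the logarithm of `m` hidden in `β`: the other logarithms use half of the budget `c * m /
K`, and `ln m` is absorbed by the other half. -/
lemma exists_beta_le {c : ℝ} (hc : 0 < c) : ∃ C : ℝ, 0 < C ∧ ∀ (K δ : ℝ) (m : ℕ), 1 ≤ K → 0 < δ →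
    δ < 1 → C * K * (Real.log K + Real.log (1 / δ) + 1) ≤ m → 1 ≤ m ∧ beta m δ ≤ c / K := by
  set M : ℝ := 2 / c + 1 with hM
  have hM1 : 1 ≤ M := by
    have : 0 < 2 / c := by positivity
    linarith
  have hMc : 1 / M ≤ c / 2 := by
    rw [div_le_div_iff₀ (by positivity) two_pos, hM, mul_add, mul_div_cancel₀ _ hc.ne']
    linarith
  set a : ℝ := Real.log 8 + Real.log M with ha
  have hlog8 : 1 ≤ Real.log 8 := by
    rw [Real.le_log_iff_exp_le (by norm_num)]
    have := Real.exp_one_lt_d9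
    linarith
  have ha1 : 1 ≤ a := by
    have := Real.log_nonneg hM1
    linarith
  refine ⟨2 * a / c, by positivity, fun K δ m hK hδ hδ1 hCm => ?_⟩
  have hK0 : 0 < K := by linarith
  set L := Real.log K + Real.log (1 / δ) + 1 with hL
  have hL1 : 1 ≤ L := by
    have h1 := Real.log_nonneg hK
    have h2 := Real.log_nonneg (one_le_one_div hδ hδ1.le)
    linarith
  have hm0 : (0 : ℝ) < m := lt_of_lt_of_le (by positivity) hCm
  refine ⟨by exact_mod_cast hm0, ?_⟩
  -- The bound `ln t ≤ t - 1` at `t = m / (K * M)`, with `M` large enough that `1 / M ≤ c / 2`.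
  have hlogm : Real.log m ≤ m / (K * M) + Real.log K + Real.log M := by
    have h1 : (m : ℝ) = m / (K * M) * (K * M) := by field_simp
    have h2 := Real.log_le_sub_one_of_pos (show 0 < m / (K * M) by positivity)
    have h3 : Real.log m = Real.log (m / (K * M)) + (Real.log K + Real.log M) := by
      conv_lhs => rw [h1]
      rw [Real.log_mul (by positivity) (by positivity), Real.log_mul (by positivity)
        (by positivity)]
    linarith
  have hlog : Real.log (8 * m / δ) = Real.log 8 + Real.log m + Real.log (1 / δ) := by
    rw [mul_div_assoc, Real.log_mul (by norm_num) (by positivity), Real.log_div (by positivity)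
      hδ.ne', Real.log_div one_ne_zero hδ.ne', Real.log_one]
    ring
  rw [beta, div_le_iff₀ hm0, hlog]
  have h1 : Real.log 8 + Real.log m + Real.log (1 / δ) ≤ a * L + m / (K * M) := by
    nlinarith
  have h2 : a * L ≤ c / K * m / 2 := by
    have : c / K * (2 * a / c * K * L) = 2 * (a * L) := by field_simp
    have := mul_le_mul_of_nonneg_left hCm (show 0 ≤ c / K by positivity)
    linarith
  have h3 : m / (K * M) ≤ c / K * m / 2 := by
    have : m / (K * M) = 1 / M * (m / K) := by field_simp
    rw [this]
    have := mul_le_mul_of_nonneg_right hMc (show 0 ≤ m / K by positivity)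
    calc _ ≤ _ := this
      _ = _ := by ring
  linarith

/-- AM-GM on `3√(βq)`. The part `η * q` will sum to `η` times the revenue; the rest is capped by a
constant of order `β / η`. -/
lemma loss_le {β q η : ℝ} (hβ : 0 ≤ β) (hq : 0 ≤ q) (hη : 0 < η) :
    loss β q ≤ η * q + min q ((9 / (4 * η) + 6) * β) := by
  have hs : 3 * √(β * q) ≤ η * q + 9 / (4 * η) * β := by
    have h : √(β * q) ≤ (η * q + 9 / (4 * η) * β) / 3 := by
      refine Real.sqrt_le_iff.2 ⟨by positivity, ?_⟩
      have : (η * q) * (9 / (4 * η) * β) = 9 / 4 * (β * q) := by field_simp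
      nlinarith [sq_nonneg (η * q - 9 / (4 * η) * β)]
    linarith
  rcases min_choice q ((9 / (4 * η) + 6) * β) with h | h <;> rw [h]
  · refine (min_le_left _ _).trans ?_
    have : 0 ≤ η * q := by positivity
    linarith
  · refine (min_le_right _ _).trans ?_
    linarith

lemma ofReal_mul_loss_le {β q η r : ℝ} (hβ : 0 ≤ β) (hq : 0 ≤ q) (hη : 0 < η) (hr : 0 ≤ r) :
    ENNReal.ofReal (r * loss β q) ≤ ENNReal.ofReal η * ENNReal.ofReal (r * q) +
      ENNReal.ofReal (r * min q ((9 / (4 * η) + 6) * β)) := by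
  rw [← ENNReal.ofReal_mul hη.le]
  refine le_trans (ENNReal.ofReal_le_ofReal ?_) ENNReal.ofReal_add_le
  calc r * loss β q ≤ r * (η * q + min q ((9 / (4 * η) + 6) * β)) :=
        mul_le_mul_of_nonneg_left (loss_le hβ hq hη) hr
    _ = _ := by ring

lemma lintegral_loss_le {β η r : ℝ} (hβ : 0 ≤ β) (hη : 0 < η) {Q : ℝ → ℝ} (hQ : Measurable Q)
    (hQ0 : ∀ x, 0 ≤ Q x) :
    ∫⁻ x in Ioi r, ENNReal.ofReal (loss β (Q x)) ≤
      (ENNReal.ofReal η * ∫⁻ x in Ioi r, ENNReal.ofReal (Q x)) +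
        ∫⁻ x in Ioi r, ENNReal.ofReal (min (Q x) ((9 / (4 * η) + 6) * β)) := by
  rw [← lintegral_const_mul _ hQ.ennreal_ofReal,
    ← lintegral_add_left (hQ.ennreal_ofReal.const_mul _)]
  refine lintegral_mono fun x => ?_
  rw [← ENNReal.ofReal_mul hη.le]
  exact le_trans (ENNReal.ofReal_le_ofReal (loss_le hβ (hQ0 x) hη)) ENNReal.ofReal_add_le

lemma revenueLoss_le {β η r : ℝ} (hβ : 0 ≤ β) (hη : 0 < η) (hr : 0 ≤ r) {F₁ F₂ : ℝ → ℝ}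
    (hF2 : Measurable F₂) (h1 : ∀ x, F₁ x ≤ 1) (h2 : ∀ x, F₂ x ≤ 1) :
    revenueLoss β r F₁ F₂ ≤ ENNReal.ofReal η * cdfRevenue r F₁ F₂ +
      (ENNReal.ofReal (r * min (1 - F₁ r) ((9 / (4 * η) + 6) * β)) +
        ∫⁻ x in Ioi r, ENNReal.ofReal (min (1 - F₂ x) ((9 / (4 * η) + 6) * β))) := by
  rw [revenueLoss, cdfRevenue, mul_add, add_add_add_comm]
  exact add_le_add (ofReal_mul_loss_le hβ (sub_nonneg.2 (h1 r)) hη hr)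
    (lintegral_loss_le hβ hη (hF2.const_sub 1) fun x => sub_nonneg.2 (h2 x))

lemma ofReal_one_sub_mul_le {a b ε : ℝ} {x y : ℝ≥0∞} (hx : x ≠ ⊤) (hb : 0 ≤ b) (hε : ε ≤ 1)
    (hab : a + b ≤ ε) (h : ENNReal.ofReal (1 - a) * x ≤ y + ENNReal.ofReal b * x) :
    ENNReal.ofReal (1 - ε) * x ≤ y := by
  have hfin : ENNReal.ofReal b * x ≠ ⊤ := ENNReal.mul_ne_top ENNReal.ofReal_ne_top hx
  refine (ENNReal.add_le_add_iff_right hfin).1 (le_trans ?_ h)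
  rw [← add_mul, ← ENNReal.ofReal_add (by linarith) hb]
  exact mul_le_mul_left (ENNReal.ofReal_le_ofReal (by linarith)) _

/-! ### Bounded values -/

section bounded

variable {n : ℕ} (μ : Measure (Fin n → ℝ)) [IsProbabilityMeasure μ] {H : ℝ}

lemma one_sub_orderCDF_eq_zero (hH : 0 ≤ H) (hμ : ∀ᵐ s ∂μ, ∀ j, s j ≤ H) (i : ℕ) {v : ℝ}
    (hv : H < v) : 1 - orderCDF μ i v = 0 := by
  rw [one_sub_orderCDF, measureReal_eq_zero_iff]
  refine measure_mono_null (fun s hs => ?_) (ae_iff.1 hμ)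
  intro hcon
  exact absurd (le_trans hs (nthHighest_le i hH hcon)) (not_le.2 hv)

lemma optimalRevenue_le_of_le (hH : 0 ≤ H) (hμ : ∀ᵐ s ∂μ, ∀ j, 0 ≤ s j ∧ s j ≤ H) :
    optimalRevenue μ ≤ ENNReal.ofReal H := by
  refine iSup₂_le fun r _ => ?_
  calc expectedRevenue r μ ≤ ∫⁻ _s, ENNReal.ofReal H ∂μ := by
        refine lintegral_mono_ae ?_
        filter_upwards [hμ] with s hs
        refine ENNReal.ofReal_le_ofReal ?_
        have h0 : highest s ≤ H := nthHighest_le 0 hH fun j => (hs j).2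
        have h1 : secondHighest s ≤ H := nthHighest_le 1 hH fun j => (hs j).2
        rw [outcomeRevenue]
        split_ifs <;> linarith
    _ = ENNReal.ofReal H := by simp

lemma one_le_optimalRevenue (hn : 1 ≤ n) (hμ : ∀ᵐ s ∂μ, ∀ j, 1 ≤ s j) :
    1 ≤ optimalRevenue μ := by
  refine le_trans ?_ (le_iSup₂_of_le (1 : ℝ) zero_le_one le_rfl)
  calc (1 : ℝ≥0∞) = ∫⁻ _s, 1 ∂μ := by simp
    _ ≤ expectedRevenue 1 μ := by
        refine lintegral_mono_ae ?_
        filter_upwards [hμ] with s hs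
        have h0 : 1 ≤ highest s := (le_highest_iff hn s 1).2 ⟨⟨0, hn⟩, hs _⟩
        rw [outcomeRevenue, if_neg (not_lt.2 h0), ENNReal.one_le_ofReal]
        split_ifs <;> linarith

/-- With `b` the constant cap from `loss_le`, a reserve `r ≤ H` loses at most `r * b` in the first
term and `(H - r) * b` in the integral, together `H * b`. Reserves above `H` earn nothing. -/
lemma optimalRevenue_le_of_bounded (hH : 0 ≤ H) (hμ : ∀ᵐ s ∂μ, ∀ j, 0 ≤ s j ∧ s j ≤ H)
    {β η r' : ℝ} (hβ : 0 ≤ β) (hη : 0 < η)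
    (h : ∀ r, 0 ≤ r → expectedRevenue r μ ≤
      expectedRevenue r' μ + revenueLoss β r (orderCDF μ 0) (orderCDF μ 1)) :
    optimalRevenue μ ≤ expectedRevenue r' μ + (ENNReal.ofReal η * optimalRevenue μ +
      ENNReal.ofReal (H * ((9 / (4 * η) + 6) * β))) := by
  have hμ0 : ∀ᵐ s ∂μ, ∀ j, 0 ≤ s j := hμ.mono fun s hs j => (hs j).1
  have hμH : ∀ᵐ s ∂μ, ∀ j, s j ≤ H := hμ.mono fun s hs j => (hs j).2
  refine iSup₂_le fun r hr => ?_
  rcases lt_or_ge H r with hHr | hHr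
  · rw [expectedRevenue_eq_cdfRevenue μ hμ0 hr, cdfRevenue,
      one_sub_orderCDF_eq_zero μ hH hμH 0 hHr, setLIntegral_congr_fun (g := fun _ => 0)
      measurableSet_Ioi fun x hx => by
        simp only
        rw [one_sub_orderCDF_eq_zero μ hH hμH 1 (hHr.trans hx), ENNReal.ofReal_zero]]
    simp
  · refine (h r hr).trans (add_le_add_right ((revenueLoss_le hβ hη hr (measurable_orderCDF μ 1)
      (orderCDF_le_one μ 0) (orderCDF_le_one μ 1)).trans (add_le_add ?_ ?_)) _)
    · refine mul_le_mul_right ?_ _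
      rw [← expectedRevenue_eq_cdfRevenue μ hμ0 hr]
      exact le_iSup₂_of_le r hr le_rfl
    · have hb : 0 ≤ (9 / (4 * η) + 6) * β := by positivity
      generalize (9 / (4 * η) + 6) * β = b at hb ⊢
      have hint : ∫⁻ x in Ioi r, ENNReal.ofReal (min (1 - orderCDF μ 1 x) b) ≤
          ENNReal.ofReal ((H - r) * b) := by
        calc ∫⁻ x in Ioi r, ENNReal.ofReal (min (1 - orderCDF μ 1 x) b)
            ≤ ∫⁻ x in Ioi r, (Iic H).indicator (fun _ => ENNReal.ofReal b) x := by
              refine lintegral_mono fun x => ?_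
              by_cases hx : x ∈ Iic H
              · rw [indicator_of_mem hx]
                exact ENNReal.ofReal_le_ofReal (min_le_right _ _)
              · rw [indicator_of_notMem hx, one_sub_orderCDF_eq_zero μ hH hμH 1 (not_le.1 hx)]
                simp [min_eq_left hb]
          _ = ENNReal.ofReal ((H - r) * b) := by
              rw [lintegral_indicator measurableSet_Iic, Measure.restrict_restrict
                measurableSet_Iic, setLIntegral_const, inter_comm, Ioi_inter_Iic, Real.volume_Ioc,
                mul_comm, ENNReal.ofReal_mul (p := H - r) (by linarith)]
      refine (add_le_add (ENNReal.ofReal_le_ofReal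
        (mul_le_mul_of_nonneg_left (min_le_right _ _) hr)) hint).trans ?_
      rw [← ENNReal.ofReal_add (mul_nonneg hr hb) (mul_nonneg (by linarith) hb)]
      exact ENNReal.ofReal_le_ofReal (by linarith)

end bounded

theorem learnsReserve_of_mem_Icc_zero_one {n : ℕ} (μ : Measure (Fin n → ℝ))
    [IsProbabilityMeasure μ] (hμ : ∀ᵐ s ∂μ, ∀ j, s j ∈ Icc (0 : ℝ) 1) {m : ℕ} (hm : 1 ≤ m)
    {ε δ : ℝ} (hε : 0 < ε) (hε1 : ε < 1) (hδ : 0 < δ) (hδ1 : δ < 1)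
    (hβε : beta m δ ≤ ε ^ 2 / 84) :
    LearnsReserve μ m δ fun r =>
      optimalRevenue μ ≤ expectedRevenue r μ + ENNReal.ofReal ε := by
  refine learnsReserve_of_revenueLoss μ (hμ.mono fun s hs j => (hs j).1) hm hδ hδ1
    fun r' _ h => ?_
  have hβ := beta_nonneg hm hδ hδ1
  refine (optimalRevenue_le_of_bounded μ zero_le_one hμ hβ
    (show 0 < ε / 16 by positivity) h).trans (add_le_add_right ?_ _)
  refine (add_le_add_left (mul_le_mul_right (optimalRevenue_le_of_le μ zero_le_one hμ) _) _).trans ?_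
  rw [ENNReal.ofReal_one, mul_one, ← ENNReal.ofReal_add (by positivity) (by positivity)]
  refine ENNReal.ofReal_le_ofReal ?_
  -- The choice `η = ε / 16` gives `36 / ε + 6`; the constant `84 = 2 * 42` then makes the capped
  -- part at most `ε / 2`.
  have h1 : 9 / (4 * (ε / 16)) + 6 ≤ 42 / ε := by
    rw [le_div_iff₀ hε, add_mul]
    have : 9 / (4 * (ε / 16)) * ε = 36 := by field_simp; norm_num
    linarith
  have h2 := mul_le_mul h1 hβε hβ (by positivity)
  have h3 : 42 / ε * (ε ^ 2 / 84) = ε / 2 := by field_simp; norm_num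
  linarith

theorem learnsReserve_of_mem_Icc_one {n : ℕ} (hn : 1 ≤ n) (μ : Measure (Fin n → ℝ))
    [IsProbabilityMeasure μ] {H : ℝ} (hH : 1 ≤ H) (hμ : ∀ᵐ s ∂μ, ∀ j, s j ∈ Icc 1 H) {m : ℕ}
    (hm : 1 ≤ m) {ε δ : ℝ} (hε : 0 < ε) (hε1 : ε < 1) (hδ : 0 < δ) (hδ1 : δ < 1)
    (hβε : beta m δ ≤ ε ^ 2 / H / 84) :
    LearnsReserve μ m δ fun r =>
      ENNReal.ofReal (1 - ε) * optimalRevenue μ ≤ expectedRevenue r μ := by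
  have hμ' : ∀ᵐ s ∂μ, ∀ j, 0 ≤ s j ∧ s j ≤ H :=
    hμ.mono fun s hs j => ⟨zero_le_one.trans (hs j).1, (hs j).2⟩
  have hH0 : 0 < H := by linarith
  refine learnsReserve_of_revenueLoss μ (hμ'.mono fun s hs j => (hs j).1) hm hδ hδ1
    fun r' _ h => ?_
  have hβ := beta_nonneg hm hδ hδ1
  have hfin : optimalRevenue μ ≠ ⊤ :=
    ((optimalRevenue_le_of_le μ hH0.le hμ').trans_lt ENNReal.ofReal_lt_top).ne
  refine ofReal_one_sub_mul_le (a := 0) (b := ε / 16 + ε / 2) hfin (by positivity) hε1.le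
    (by linarith) ?_
  rw [sub_zero, ENNReal.ofReal_one, one_mul, ENNReal.ofReal_add (by positivity) (by positivity),
    add_mul]
  refine (optimalRevenue_le_of_bounded μ hH0.le hμ' hβ
    (show 0 < ε / 16 by positivity) h).trans (add_le_add_right (add_le_add_right ?_ _) _)
  -- The additive error becomes multiplicative because the optimal revenue is at least `1`.
  refine le_trans (ENNReal.ofReal_le_ofReal (q := ε / 2) ?_)
    (le_mul_of_one_le_right zero_le (one_le_optimalRevenue μ hn
      (hμ.mono fun s hs j => (hs j).1)))
  have h1 : 9 / (4 * (ε / 16)) + 6 ≤ 42 / ε := by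
    rw [le_div_iff₀ hε, add_mul]
    have : 9 / (4 * (ε / 16)) * ε = 36 := by field_simp; norm_num
    linarith
  have h2 := mul_le_mul h1 hβε hβ (by positivity)
  have h3 : H * (42 / ε * (ε ^ 2 / H / 84)) = ε / 2 := by field_simp; norm_num
  have h4 := mul_le_mul_of_nonneg_left h2 hH0.le
  linarith

/-! ### Independent values -/

lemma one_add_sum_le_prod_one_add {ι : Type*} (s : Finset ι) (q : ι → ℝ) (h0 : ∀ j, 0 ≤ q j) :
    1 + ∑ j ∈ s, q j ≤ ∏ j ∈ s, (1 + q j) := by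
  classical
  induction s using Finset.induction_on with
  | empty => simp
  | insert a s ha ih =>
    rw [Finset.sum_insert ha, Finset.prod_insert ha]
    have h1 := mul_le_mul_of_nonneg_left ih (show 0 ≤ 1 + q a by linarith [h0 a])
    nlinarith [mul_nonneg (h0 a) (Finset.sum_nonneg fun j (_ : j ∈ s) => h0 j)]

lemma one_sub_prod_one_sub_le_sum {ι : Type*} (s : Finset ι) (q : ι → ℝ) (h0 : ∀ j, 0 ≤ q j)
    (h1 : ∀ j, q j ≤ 1) : 1 - ∏ j ∈ s, (1 - q j) ≤ ∑ j ∈ s, q j := by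
  classical
  induction s using Finset.induction_on with
  | empty => simp
  | insert a s ha ih =>
    rw [Finset.sum_insert ha, Finset.prod_insert ha]
    have h2 : ∏ j ∈ s, (1 - q j) ≤ 1 := Finset.prod_le_one
      (fun j _ => sub_nonneg.2 (h1 j)) fun j _ => sub_le_self _ (h0 j)
    nlinarith [h0 a, h1 a]

/-- Follows from `(1 - q)(1 + q) ≤ 1` and `1 + ∑ q ≤ ∏ (1 + q)`. It is a converse to the union
bound: when nobody reaching `v` is likely, the sum of the individual probabilities is close to the
probability of the union. -/
lemma prod_one_sub_mul_sum_le {ι : Type*} (s : Finset ι) (q : ι → ℝ) (h0 : ∀ j, 0 ≤ q j)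
    (h1 : ∀ j, q j ≤ 1) : (∏ j ∈ s, (1 - q j)) * ∑ j ∈ s, q j ≤ 1 - ∏ j ∈ s, (1 - q j) := by
  have h2 : 1 + ∑ j ∈ s, q j ≤ ∏ j ∈ s, (1 + q j) :=
    one_add_sum_le_prod_one_add s q h0
  have h3 : (∏ j ∈ s, (1 - q j)) * ∏ j ∈ s, (1 + q j) ≤ 1 := by
    rw [← Finset.prod_mul_distrib]
    refine Finset.prod_le_one (fun j _ => ?_) fun j _ => ?_
    · exact mul_nonneg (sub_nonneg.2 (h1 j)) (by linarith [h0 j])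
    · nlinarith [h0 j]
  have h4 := mul_le_mul_of_nonneg_left h2
    (Finset.prod_nonneg fun j (_ : j ∈ s) => sub_nonneg.2 (h1 j))
  linarith

section independent

variable {n : ℕ} (ν : Fin n → Measure ℝ) [∀ j, IsProbabilityMeasure (ν j)]

lemma orderCDF_zero_pi (hn : 1 ≤ n) (v : ℝ) :
    orderCDF (Measure.pi ν) 0 v = ∏ j, leftCDF (ν j) v := by
  have : {s : Fin n → ℝ | nthHighest 0 s < v} = Set.univ.pi fun _ => Iio v := by
    ext s
    rw [mem_univ_pi]
    change nthHighest 0 s < v ↔ ∀ j, s j < v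
    rw [← not_le, le_highest_iff hn]
    push Not
    rfl
  rw [orderCDF, this, measureReal_def, Measure.pi_pi, ENNReal.toReal_prod]
  rfl

lemma orderCDF_mul_sum_le (hn : 1 ≤ n) (v : ℝ) :
    orderCDF (Measure.pi ν) 0 v * ∑ j, (1 - leftCDF (ν j) v) ≤
      1 - orderCDF (Measure.pi ν) 0 v := by
  have h := prod_one_sub_mul_sum_le Finset.univ (fun j => 1 - leftCDF (ν j) v)
    (fun j => sub_nonneg.2 (leftCDF_le_one _ v)) fun j => sub_le_self _ (leftCDF_nonneg _ v)
  simp only [sub_sub_cancel] at h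
  rwa [orderCDF_zero_pi ν hn]

lemma one_sub_orderCDF_zero_le_sum (hn : 1 ≤ n) (v : ℝ) :
    1 - orderCDF (Measure.pi ν) 0 v ≤ ∑ j, (1 - leftCDF (ν j) v) := by
  rw [orderCDF_zero_pi ν hn]
  have h := one_sub_prod_one_sub_le_sum Finset.univ (fun j => 1 - leftCDF (ν j) v)
    (fun j => sub_nonneg.2 (leftCDF_le_one _ v)) fun j => sub_le_self _ (leftCDF_nonneg _ v)
  simpa only [sub_sub_cancel] using h

lemma orderCDF_zero_le_leftCDF (hn : 1 ≤ n) (v : ℝ) (j : Fin n) :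
    orderCDF (Measure.pi ν) 0 v ≤ leftCDF (ν j) v := by
  rw [orderCDF_zero_pi ν hn, ← Finset.mul_prod_erase _ _ (Finset.mem_univ j)]
  exact mul_le_of_le_one_right (leftCDF_nonneg _ v) (Finset.prod_le_one
    (fun i _ => leftCDF_nonneg _ v) fun i _ => leftCDF_le_one _ v)

lemma one_sub_orderCDF_one_le_sum_sq {v : ℝ} (hv : 0 < v) :
    1 - orderCDF (Measure.pi ν) 1 v ≤ (∑ j, (1 - leftCDF (ν j) v)) ^ 2 := by
  classical
  rw [one_sub_orderCDF]
  have hsub : {s : Fin n → ℝ | v ≤ nthHighest 1 s} ⊆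
      ⋃ p : Fin n × Fin n, {s | p.1 ≠ p.2 ∧ v ≤ s p.1 ∧ v ≤ s p.2} := by
    intro s hs
    obtain ⟨i, j, hij, hi, hj⟩ := (le_secondHighest_iff s hv).1 hs
    exact mem_iUnion.2 ⟨(i, j), hij, hi, hj⟩
  have hpair : ∀ p : Fin n × Fin n,
      (Measure.pi ν).real {s | p.1 ≠ p.2 ∧ v ≤ s p.1 ∧ v ≤ s p.2} ≤
        (1 - leftCDF (ν p.1) v) * (1 - leftCDF (ν p.2) v) := by
    rintro ⟨i, j⟩
    have hnn : 0 ≤ (1 - leftCDF (ν i) v) * (1 - leftCDF (ν j) v) :=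
      mul_nonneg (sub_nonneg.2 (leftCDF_le_one _ v)) (sub_nonneg.2 (leftCDF_le_one _ v))
    by_cases hij : i = j
    · have : {s : Fin n → ℝ | i ≠ j ∧ v ≤ s i ∧ v ≤ s j} = ∅ := by
        ext s
        simp [hij]
      simp only [this, measureReal_empty]
      exact hnn
    · have hind := (ProbabilityTheory.iIndepFun_pi (μ := ν) (X := fun _ x => x)
        fun _ => aemeasurable_id).indepFun hij
      have hmeas := hind.measure_inter_preimage_eq_mul (Ici v) (Ici v) measurableSet_Ici
        measurableSet_Ici
      have heval : ∀ k, (Measure.pi ν) ((fun s : Fin n → ℝ => s k) ⁻¹' Ici v) = ν k (Ici v) :=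
        fun k => (measurePreserving_eval ν k).measure_preimage measurableSet_Ici.nullMeasurableSet
      rw [heval, heval] at hmeas
      have hset : {s : Fin n → ℝ | i ≠ j ∧ v ≤ s i ∧ v ≤ s j} =
          (fun s : Fin n → ℝ => s i) ⁻¹' Ici v ∩ (fun s : Fin n → ℝ => s j) ⁻¹' Ici v := by
        ext s
        exact and_iff_right hij
      simp only
      rw [hset, measureReal_def, hmeas, ENNReal.toReal_mul, one_sub_leftCDF, one_sub_leftCDF]
      rfl
  calc (Measure.pi ν).real {s | v ≤ nthHighest 1 s}
      ≤ (Measure.pi ν).real (⋃ p : Fin n × Fin n, {s | p.1 ≠ p.2 ∧ v ≤ s p.1 ∧ v ≤ s p.2}) :=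
        measureReal_mono hsub
    _ ≤ ∑ p : Fin n × Fin n,
          (Measure.pi ν).real {s | p.1 ≠ p.2 ∧ v ≤ s p.1 ∧ v ≤ s p.2} :=
        measureReal_iUnion_fintype_le _
    _ ≤ ∑ p : Fin n × Fin n, (1 - leftCDF (ν p.1) v) * (1 - leftCDF (ν p.2) v) :=
        Finset.sum_le_sum fun p _ => hpair p
    _ = (∑ j, (1 - leftCDF (ν j) v)) ^ 2 := by
        rw [sq, Finset.sum_mul_sum, Fintype.sum_prod_type]

/-- If `F₁ ≥ 1/2`, the sum of the survival probabilities is at most `2(1 - F₁)` and the union bound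
over pairs squares it; if `F₁ < 1/2`, the right side exceeds `1`. -/
lemma one_sub_orderCDF_one_le (hn : 1 ≤ n) {v : ℝ} (hv : 0 < v) :
    1 - orderCDF (Measure.pi ν) 1 v ≤ 4 * (1 - orderCDF (Measure.pi ν) 0 v) ^ 2 := by
  have h1 := orderCDF_mul_sum_le ν hn v
  have h2 := one_sub_orderCDF_one_le_sum_sq ν hv
  have h3 : 0 ≤ ∑ j, (1 - leftCDF (ν j) v) :=
    Finset.sum_nonneg fun j _ => sub_nonneg.2 (leftCDF_le_one _ v)
  have h4 := orderCDF_nonneg (Measure.pi ν) 1 v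
  rcases le_or_gt (1 / 2) (orderCDF (Measure.pi ν) 0 v) with h | h
  · have h5 : ∑ j, (1 - leftCDF (ν j) v) ≤ 2 * (1 - orderCDF (Measure.pi ν) 0 v) := by
      linarith [mul_le_mul_of_nonneg_right h h3]
    have h6 := pow_le_pow_left₀ h3 h5 2
    linarith
  · nlinarith

lemma ae_pi_nonneg (h0 : ∀ j, ν j (Iio 0) = 0) : ∀ᵐ s ∂Measure.pi ν, ∀ j, 0 ≤ s j := by
  rw [ae_all_iff]
  intro j
  refine (measurePreserving_eval ν j).quasiMeasurePreserving.ae (p := fun x => 0 ≤ x) ?_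
  rw [ae_iff]
  simp only [not_le]
  exact h0 j

end independent

/-! ### Tail integrals and approximately optimal reserves -/

/-- Splits at `T`: the constant bound is used below and the quadratic tail above. -/
lemma lintegral_Ioi_le_of_le_div_sq {g : ℝ → ℝ} {b K T r : ℝ} (hb : 0 ≤ b) (hK : 0 ≤ K)
    (hT : 0 < T) (hr : 0 ≤ r) (h1 : ∀ x, 0 < x → g x ≤ b) (h2 : ∀ x, 0 < x → g x ≤ K / x ^ 2) :
    ∫⁻ x in Ioi r, ENNReal.ofReal (g x) ≤ ENNReal.ofReal (T * b + K / T) := by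
  have hI : ∫⁻ x in Ioi T, ENNReal.ofReal (K * x ^ (-2 : ℝ)) = ENNReal.ofReal (K / T) := by
    rw [← ofReal_integral_eq_lintegral_ofReal
      ((integrableOn_Ioi_rpow_of_lt (by norm_num) hT).const_mul K)]
    · rw [integral_const_mul, integral_Ioi_rpow_of_lt (by norm_num) hT]
      congr 1
      have : ((-2 : ℝ) + 1) = -1 := by norm_num
      rw [this, Real.rpow_neg_one]
      field_simp
    · filter_upwards [ae_restrict_mem measurableSet_Ioi] with x hx
      have : 0 < x := hT.trans hx
      positivity
  calc ∫⁻ x in Ioi r, ENNReal.ofReal (g x) ≤ ∫⁻ x in Ioi 0, ENNReal.ofReal (g x) :=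
        lintegral_mono_set (Ioi_subset_Ioi hr)
    _ ≤ (∫⁻ x in Ioc 0 T, ENNReal.ofReal (g x)) + ∫⁻ x in Ioi T, ENNReal.ofReal (g x) := by
        rw [← Ioc_union_Ioi_eq_Ioi hT.le]
        exact lintegral_union_le _ _ _
    _ ≤ (∫⁻ _x in Ioc 0 T, ENNReal.ofReal b) +
          ∫⁻ x in Ioi T, ENNReal.ofReal (K * x ^ (-2 : ℝ)) := by
        refine add_le_add (setLIntegral_mono' measurableSet_Ioc fun x hx =>
          ENNReal.ofReal_le_ofReal (h1 x hx.1)) (setLIntegral_mono' measurableSet_Ioi fun x hx =>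
          ENNReal.ofReal_le_ofReal ?_)
        have hx0 : 0 < x := hT.trans hx
        rw [Real.rpow_neg hx0.le, Real.rpow_two, ← div_eq_mul_inv]
        exact h2 x hx0
    _ = ENNReal.ofReal (T * b + K / T) := by
        rw [hI, setLIntegral_const, Real.volume_Ioc, sub_zero, mul_comm, ← ENNReal.ofReal_mul hT.le,
          ← ENNReal.ofReal_add (by positivity) (by positivity)]

section optimal

variable {n : ℕ} (μ : Measure (Fin n → ℝ)) [IsProbabilityMeasure μ]

lemma exists_orderCDF_quantile (hμ : ∀ᵐ s ∂μ, ∀ j, 0 ≤ s j) (i : ℕ) {a : ℝ} (ha : 0 ≤ a)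
    (ha1 : a < 1) : ∃ v, 0 ≤ v ∧ orderCDF μ i v ≤ a ∧ ∀ w > v, a < orderCDF μ i w := by
  have hX := measurable_nthHighest (n := n) i
  have hν : IsProbabilityMeasure (μ.map (nthHighest i)) :=
    Measure.isProbabilityMeasure_map hX.aemeasurable
  have hF : ∀ v, orderCDF μ i v = leftCDF (μ.map (nthHighest i)) v := fun v => by
    rw [leftCDF, map_measureReal_apply hX measurableSet_Iio]
    rfl
  simp only [hF]
  refine exists_quantile _ ?_ ha ha1
  rw [Measure.map_apply hX measurableSet_Iio]
  refine measure_mono_null (fun s hs => ?_) (ae_iff.1 hμ)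
  exact fun hcon => absurd (nthHighest_nonneg i hcon) (not_le.2 hs)

lemma optimalRevenue_ne_top (hμ : ∀ᵐ s ∂μ, ∀ j, 0 ≤ s j) {B : ℝ}
    (hB : ∀ r, 0 ≤ r → r * (1 - orderCDF μ 0 r) ≤ B)
    (h2 : ∀ v, 0 < v → 1 - orderCDF μ 1 v ≤ 4 * (1 - orderCDF μ 0 v) ^ 2) :
    optimalRevenue μ ≠ ⊤ := by
  have hB0 : 0 ≤ B := by simpa using hB 0 le_rfl
  have hle : optimalRevenue μ ≤ ENNReal.ofReal B + ENNReal.ofReal (1 * 1 + 4 * B ^ 2 / 1) := by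
    refine iSup₂_le fun r hr => ?_
    rw [expectedRevenue_eq_cdfRevenue μ hμ hr]
    refine add_le_add (ENNReal.ofReal_le_ofReal (hB r hr)) (lintegral_Ioi_le_of_le_div_sq
      zero_le_one (by positivity) one_pos hr (fun x _ => ?_) fun x hx => ?_)
    · linarith [orderCDF_nonneg μ 1 x]
    · refine (h2 x hx).trans ?_
      rw [le_div_iff₀ (by positivity)]
      have h3 := hB x hx.le
      have h4 : 0 ≤ x * (1 - orderCDF μ 0 x) :=
        mul_nonneg hx.le (sub_nonneg.2 (orderCDF_le_one μ 0 x))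
      nlinarith
  exact ne_top_of_le_ne_top (ENNReal.add_ne_top.2 ⟨ENNReal.ofReal_ne_top, ENNReal.ofReal_ne_top⟩) hle

lemma mul_one_sub_orderCDF_le (hμ : ∀ᵐ s ∂μ, ∀ j, 0 ≤ s j) (hfin : optimalRevenue μ ≠ ⊤) {r : ℝ}
    (hr : 0 ≤ r) : r * (1 - orderCDF μ 0 r) ≤ (optimalRevenue μ).toReal := by
  refine (ENNReal.ofReal_le_iff_le_toReal hfin).1 ?_
  refine le_trans ?_ (le_iSup₂_of_le r hr le_rfl)
  rw [expectedRevenue_eq_cdfRevenue μ hμ hr]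
  exact le_self_add

/-- Lowering the reserve only enlarges the tail integral, so it suffices to compare the first terms.
-/
lemma mul_expectedRevenue_le (hμ : ∀ᵐ s ∂μ, ∀ j, 0 ≤ s j) {k x r : ℝ} (hk : 0 ≤ k) (hk1 : k ≤ 1)
    (hx : 0 ≤ x) (hxr : x ≤ r)
    (h : k * (r * (1 - orderCDF μ 0 r)) ≤ x * (1 - orderCDF μ 0 x)) :
    ENNReal.ofReal k * expectedRevenue r μ ≤ expectedRevenue x μ := by
  rw [expectedRevenue_eq_cdfRevenue μ hμ hx, expectedRevenue_eq_cdfRevenue μ hμ (hx.trans hxr),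
    cdfRevenue, cdfRevenue, mul_add, ← ENNReal.ofReal_mul hk]
  refine add_le_add (ENNReal.ofReal_le_ofReal h) ?_
  refine (mul_le_of_le_one_left zero_le ?_).trans
    (lintegral_mono_set (Ioi_subset_Ioi hxr))
  rwa [ENNReal.ofReal_le_one]

end optimal

/-- Here `G` singles out the comparison reserves: they must nearly dominate all others (cost `a`)
and have a small loss (cost `b`). -/
lemma ofReal_one_sub_mul_optimalRevenue_le {n : ℕ} (μ : Measure (Fin n → ℝ))
    (hfin : optimalRevenue μ ≠ ⊤) {a b ε β r' : ℝ}
    (hb : 0 ≤ b) (hε : ε ≤ 1) (hab : a + b ≤ ε) {G : ℝ → Prop}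
    (hdom : ∀ r, 0 ≤ r → ∃ x, 0 ≤ x ∧ G x ∧
      ENNReal.ofReal (1 - a) * expectedRevenue r μ ≤ expectedRevenue x μ)
    (hloss : ∀ x, 0 ≤ x → G x → revenueLoss β x (orderCDF μ 0) (orderCDF μ 1) ≤
      ENNReal.ofReal b * optimalRevenue μ)
    (h : ∀ r, 0 ≤ r → expectedRevenue r μ ≤
      expectedRevenue r' μ + revenueLoss β r (orderCDF μ 0) (orderCDF μ 1)) :
    ENNReal.ofReal (1 - ε) * optimalRevenue μ ≤ expectedRevenue r' μ := by
  refine ofReal_one_sub_mul_le hfin hb hε hab ?_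
  conv_lhs => rw [optimalRevenue]
  simp only [ENNReal.mul_iSup]
  refine iSup₂_le fun r hr => ?_
  obtain ⟨x, hx, hG, hle⟩ := hdom r hr
  exact hle.trans ((h x hx).trans (add_le_add_right (hloss x hx hG) _))

/-! ### Regular distributions -/

/-- Over `N` equal pieces the increments add up to order `1 / N`. This replaces a derivative test,
since the density need not be continuous. -/
lemma le_of_forall_sub_le_mul_sq {P : ℝ → ℝ} {a b M : ℝ} (hab : a ≤ b)
    (h : ∀ u v, a ≤ u → u ≤ v → v ≤ b → P v - P u ≤ M * (v - u) ^ 2) : P b ≤ P a := by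
  have hN : ∀ N : ℕ, P b - P a ≤ M * (b - a) ^ 2 / ((N + 1 : ℕ) : ℝ) := by
    intro N
    have hN0 : (0 : ℝ) < ((N + 1 : ℕ) : ℝ) := by positivity
    set K : ℝ := ((N + 1 : ℕ) : ℝ) with hK
    set u : ℕ → ℝ := fun k => a + k * ((b - a) / K) with hu
    have hstep : 0 ≤ (b - a) / K := div_nonneg (sub_nonneg.2 hab) hN0.le
    have hlast : u (N + 1) = b := by
      simp only [hu]
      rw [← hK, mul_div_cancel₀ _ hN0.ne']
      ring
    have hfirst : u 0 = a := by simp [hu]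
    have hsum : ∑ k ∈ Finset.range (N + 1), (P (u (k + 1)) - P (u k)) = P (u (N + 1)) - P (u 0) :=
      Finset.sum_range_sub (fun k => P (u k)) (N + 1)
    rw [hlast, hfirst] at hsum
    rw [← hsum]
    calc ∑ k ∈ Finset.range (N + 1), (P (u (k + 1)) - P (u k))
        ≤ ∑ _k ∈ Finset.range (N + 1), M * ((b - a) / K) ^ 2 := by
          refine Finset.sum_le_sum fun k hk => ?_
          have hk' : k + 1 ≤ N + 1 := Finset.mem_range.1 hk
          have hdiff : u (k + 1) - u k = (b - a) / K := by
            simp only [hu]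
            push_cast
            ring
          rw [← hdiff]
          refine h _ _ ?_ (by linarith) ?_
          · have : 0 ≤ (k : ℝ) * ((b - a) / K) := by positivity
            simp only [hu]
            linarith
          · rw [← hlast]
            simp only [hu]
            gcongr
      _ = M * (b - a) ^ 2 / K := by
          rw [Finset.sum_const, Finset.card_range, nsmul_eq_mul]
          rw [← hK]
          field_simp
  have hlim := ((tendsto_const_div_atTop_nhds_zero_nat (M * (b - a) ^ 2)).comp
    (Filter.tendsto_add_atTop_nat 1))
  have := ge_of_tendsto' hlim hN
  linarith

/-- Formally the derivative of `q t * (t - c)` is `q t - f t * (t - c)`, which is non-positive when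
the virtual value `t - q t / f t` is at least `c`. -/
lemma mul_sub_le_of_density_ge {q f : ℝ → ℝ} {a b c : ℝ} (hab : a ≤ b) (hc : c < a)
    (hq : Antitone q) (hq0 : ∀ t, 0 ≤ q t) (hq1 : ∀ t, q t ≤ 1)
    (hf : ∀ t, a ≤ t → t ≤ b → q t ≤ f t * (t - c))
    (hint : ∀ u v k, a ≤ u → u ≤ v → v ≤ b → 0 ≤ k → (∀ t, u ≤ t → t ≤ v → k ≤ f t) →
      k * (v - u) ≤ q u - q v) : q b * (b - c) ≤ q a * (a - c) := by
  refine le_of_forall_sub_le_mul_sq (P := fun t => q t * (t - c)) (M := 1 / (a - c)) hab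
    fun u v hau huv hvb => ?_
  have hvc : 0 < v - c := by linarith
  have h1 := hint u v (q v / (v - c)) hau huv hvb (div_nonneg (hq0 v) hvc.le) fun t hut htv => by
    have htc : 0 < t - c := by linarith
    rw [div_le_iff₀ hvc]
    have h2 := hf t (hau.trans hut) (htv.trans hvb)
    have hft : 0 ≤ f t := by
      by_contra hneg
      nlinarith [hq0 t]
    have := hq htv
    nlinarith
  have h2 : q v / (v - c) * (v - u) ^ 2 ≤ 1 / (a - c) * (v - u) ^ 2 := by
    refine mul_le_mul_of_nonneg_right ?_ (sq_nonneg _)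
    exact div_le_div₀ zero_le_one (hq1 v) (by linarith) (by linarith)
  have h3 := mul_le_mul_of_nonneg_right h1 (show 0 ≤ u - c by linarith)
  have h4 : q v / (v - c) * (v - u) * (u - c) =
      q v * (v - u) - q v / (v - c) * (v - u) ^ 2 := by
    field_simp
    ring
  linarith

lemma mul_sub_le_of_density_le {q f : ℝ → ℝ} {a b c : ℝ} (hab : a ≤ b) (hc : c < a)
    (hq : Antitone q) (hq0 : ∀ t, 0 ≤ q t) (hq1 : ∀ t, q t ≤ 1)
    (hf : ∀ t, a ≤ t → t ≤ b → f t * (t - c) ≤ q t)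
    (hint : ∀ u v k, a ≤ u → u ≤ v → v ≤ b → 0 ≤ k → (∀ t, u ≤ t → t ≤ v → f t ≤ k) →
      q u - q v ≤ k * (v - u)) : q a * (a - c) ≤ q b * (b - c) := by
  have key := le_of_forall_sub_le_mul_sq (P := fun t => -(q t * (t - c))) (M := 1 / (a - c)) hab
    fun u v hau huv hvb => ?_
  · linarith
  have huc : 0 < u - c := by linarith
  have h1 := hint u v (q u / (u - c)) hau huv hvb (div_nonneg (hq0 u) huc.le) fun t hut htv => by
    have htc : 0 < t - c := by linarith
    have h2 := hf t (hau.trans hut) (htv.trans hvb)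
    rw [← le_div_iff₀ htc] at h2
    exact h2.trans (div_le_div₀ (hq0 u) (hq hut) huc (by linarith))
  have h2 : q u / (u - c) * (v - u) ^ 2 ≤ 1 / (a - c) * (v - u) ^ 2 := by
    refine mul_le_mul_of_nonneg_right ?_ (sq_nonneg _)
    exact div_le_div₀ zero_le_one (hq1 u) (by linarith) (by linarith)
  have h3 := mul_le_mul_of_nonneg_right h1 (show 0 ≤ v - c by linarith)
  have h4 : q u / (u - c) * (v - u) * (v - c) =
      q u * (v - u) + q u / (u - c) * (v - u) ^ 2 := by
    field_simp
    ring
  linarith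

/-! ### Increments of the CDF from bounds on the density. -/

section density

variable {ν : Measure ℝ} {f : ℝ → ℝ} {I : Set ℝ}

lemma measure_Ico_eq_lintegral
    (hden : ν.restrict I = (volume.restrict I).withDensity fun v => ENNReal.ofReal (f v))
    {u v : ℝ} (hI : Icc u v ⊆ I) : ν (Ico u v) = ∫⁻ t in Ico u v, ENNReal.ofReal (f t) := by
  have h := congrArg (fun m => m (Ico u v)) hden
  have hinter : Ico u v ∩ I = Ico u v := inter_eq_left.2 (Ico_subset_Icc_self.trans hI)
  rwa [Measure.restrict_apply measurableSet_Ico, withDensity_apply _ measurableSet_Ico,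
    Measure.restrict_restrict measurableSet_Ico, hinter] at h

variable [IsProbabilityMeasure ν]

lemma leftCDF_sub (ν : Measure ℝ) [IsProbabilityMeasure ν] {u v : ℝ} (huv : u ≤ v) :
    leftCDF ν v - leftCDF ν u = ν.real (Ico u v) := by
  rw [leftCDF, leftCDF, ← Iio_union_Ico_eq_Iio huv, measureReal_union _ measurableSet_Ico,
    add_sub_cancel_left]
  exact Set.disjoint_left.2 fun x hx hx' => absurd hx'.1 (not_le.2 hx)

lemma mul_sub_le_leftCDF_sub
    (hden : ν.restrict I = (volume.restrict I).withDensity fun v => ENNReal.ofReal (f v))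
    {u v k : ℝ} (huv : u ≤ v) (hI : Icc u v ⊆ I) (hk : 0 ≤ k)
    (h : ∀ t, u ≤ t → t ≤ v → k ≤ f t) : k * (v - u) ≤ leftCDF ν v - leftCDF ν u := by
  rw [leftCDF_sub ν huv, measureReal_def, ← ENNReal.ofReal_le_iff_le_toReal (measure_ne_top _ _),
    measure_Ico_eq_lintegral hden hI, ENNReal.ofReal_mul hk, ← Real.volume_Ico,
    ← setLIntegral_const]
  exact setLIntegral_mono' measurableSet_Ico fun t ht =>
    ENNReal.ofReal_le_ofReal (h t ht.1 ht.2.le)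

lemma leftCDF_sub_le_mul_sub
    (hden : ν.restrict I = (volume.restrict I).withDensity fun v => ENNReal.ofReal (f v))
    {u v k : ℝ} (huv : u ≤ v) (hI : Icc u v ⊆ I) (hk : 0 ≤ k)
    (h : ∀ t, u ≤ t → t ≤ v → f t ≤ k) : leftCDF ν v - leftCDF ν u ≤ k * (v - u) := by
  rw [leftCDF_sub ν huv, measureReal_def]
  refine ENNReal.toReal_le_of_le_ofReal (mul_nonneg hk (sub_nonneg.2 huv)) ?_
  rw [measure_Ico_eq_lintegral hden hI, ENNReal.ofReal_mul hk, ← Real.volume_Ico,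
    ← setLIntegral_const]
  exact setLIntegral_mono' measurableSet_Ico fun t ht =>
    ENNReal.ofReal_le_ofReal (h t ht.1 ht.2.le)

end density

/-! ### The support of a continuous distribution. -/

section support

variable {ν : Measure ℝ}

lemma exists_mem_support_lt {x : ℝ} (h : leftCDF ν x ≠ 0) : ∃ s ∈ ν.support, s < x := by
  have hpos : 0 < ν (Iio x) := by
    rw [pos_iff_ne_zero]
    intro h0
    exact h (by rw [leftCDF, measureReal_def, h0, ENNReal.toReal_zero])
  obtain ⟨s, hs, hsS⟩ := Measure.nonempty_inter_support_of_pos hpos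
  exact ⟨s, hsS, hs⟩

lemma IsContinuousDist.support_subset (h : IsContinuousDist ν) : ν.support ⊆ Ici 0 := by
  refine Measure.support_subset_of_isClosed isClosed_Ici ?_
  rw [mem_ae_iff, compl_Ici]
  exact h.nonneg

lemma IsContinuousDist.bddBelow (h : IsContinuousDist ν) : BddBelow ν.support :=
  ⟨0, fun _ hx => h.support_subset hx⟩

lemma IsContinuousDist.leftCDF_sInf (h : IsContinuousDist ν) : leftCDF ν (sInf ν.support) = 0 := by
  by_contra hne
  obtain ⟨s, hs, hlt⟩ := exists_mem_support_lt hne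
  exact absurd (csInf_le h.bddBelow hs) (not_le.2 hlt)

variable [IsProbabilityMeasure ν]

lemma exists_mem_support_ge {x : ℝ} (h : leftCDF ν x < 1) : ∃ s ∈ ν.support, x ≤ s := by
  have hpos : 0 < ν (Ici x) := by
    rw [pos_iff_ne_zero]
    intro h0
    have := one_sub_leftCDF ν x
    rw [measureReal_def, h0, ENNReal.toReal_zero] at this
    linarith
  obtain ⟨s, hs, hsS⟩ := Measure.nonempty_inter_support_of_pos hpos
  exact ⟨s, hsS, hs⟩

lemma IsContinuousDist.sInf_mem (h : IsContinuousDist ν) : sInf ν.support ∈ ν.support :=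
  Measure.isClosed_support.csInf_mem (Measure.nonempty_support (NeZero.ne ν)) h.bddBelow

/-- A support point above the infimum excludes an atom at the infimum, so the CDF tends to `0` there
from the right. -/
lemma IsContinuousDist.exists_leftCDF_lt (h : IsContinuousDist ν) {x s η : ℝ}
    (hs : s ∈ ν.support) (hlt : sInf ν.support < s) (hx : sInf ν.support < x) (hη : 0 < η) :
    ∃ u, sInf ν.support < u ∧ u < x ∧ leftCDF ν u < η := by
  set a := sInf ν.support
  have hatom : ν {a} = 0 := by
    by_contra hne
    exact absurd (h.atom a hne hs) (not_le.2 hlt)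
  have hIic : ProbabilityTheory.cdf ν a = 0 := by
    rw [ProbabilityTheory.cdf_eq_real, ← Iio_union_right, measureReal_def,
      measure_union_null _ hatom, ENNReal.toReal_zero]
    have := h.leftCDF_sInf
    rwa [leftCDF, measureReal_eq_zero_iff] at this
  have hcont := ((ProbabilityTheory.cdf ν).right_continuous a).mono_left
    (nhdsWithin_mono a (Ioi_subset_Ici_self (a := a)))
  have hev : ∀ᶠ u in nhdsWithin a (Ioi a), ProbabilityTheory.cdf ν u < η :=
    hcont.eventually (gt_mem_nhds (by rwa [hIic]))
  obtain ⟨u, hu, hau, hux⟩ := (hev.and (Ioo_mem_nhdsGT hx)).exists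
  refine ⟨u, hau, hux, lt_of_le_of_lt ?_ hu⟩
  rw [ProbabilityTheory.cdf_eq_real]
  exact measureReal_mono Iio_subset_Iic_self

end support

/-- Concavity of the revenue curve `q ↦ q * v(q)`, whose slope is the virtual value. The survival
probability of `x` lies between that of `r` and `1`, the curve is non-negative at `1`, and the
weight on `r` is at least `F x`. -/
theorem IsRegular.mul_one_sub_leftCDF_mul_le {ν : Measure ℝ} [IsProbabilityMeasure ν]
    (hν : IsRegular ν) {x r : ℝ} (hx : 0 ≤ x) (hxr : x ≤ r) :
    r * (1 - leftCDF ν r) * leftCDF ν x ≤ x * (1 - leftCDF ν x) := by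
  obtain ⟨hdist, f, -, hfpos, hden, hmono⟩ := hν
  set F := leftCDF ν with hF
  set q : ℝ → ℝ := fun v => 1 - F v with hqdef
  have hF0 : ∀ v, 0 ≤ F v := leftCDF_nonneg ν
  have hF1 : ∀ v, F v ≤ 1 := leftCDF_le_one ν
  have hq : Antitone q := fun u v h => sub_le_sub_left (leftCDF_mono ν h) 1
  have hq0 : ∀ v, 0 ≤ q v := fun v => sub_nonneg.2 (hF1 v)
  have hq1 : ∀ v, q v ≤ 1 := fun v => sub_le_self _ (hF0 v)
  change r * q r * F x ≤ x * q x
  have hrhs : 0 ≤ x * q x := mul_nonneg hx (hq0 x)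
  rcases (hF0 x).eq_or_lt with h | hFx
  · rwa [← h, mul_zero]
  rcases (hq0 r).eq_or_lt with h | hqr
  · rwa [← h, mul_zero, zero_mul]
  obtain ⟨s1, hs1, hs1x⟩ := exists_mem_support_lt (ν := ν) hFx.ne'
  obtain ⟨s2, hs2, hrs2⟩ := exists_mem_support_ge (ν := ν) (x := r) (sub_pos.1 hqr)
  set a := sInf ν.support with ha
  have has1 : a ≤ s1 := csInf_le hdist.bddBelow hs1
  have haS : a ∈ ν.support := hdist.sInf_mem
  have ha0 : 0 ≤ a := hdist.support_subset haS
  set I := interior ν.support with hI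
  have hIoo : Ioo a s2 ⊆ I :=
    interior_maximal (Ioo_subset_Icc_self.trans (hdist.interval.out haS hs2)) isOpen_Ioo
  -- Points `y < r` stay in the interior of the support, while `r` may be its supremum and carry an
  -- atom; `r` is reached by `y → r` at the end.
  have hcore : ∀ y, x < y → y < r → y * q y * F x ≤ x * q x := by
    intro y hxy hyr
    have hmemI : ∀ t, a < t → t ≤ y → t ∈ I := fun t h1 h2 =>
      hIoo ⟨h1, lt_of_le_of_lt h2 (hyr.trans_le hrs2)⟩
    have hax : a < x := lt_of_le_of_lt has1 hs1x
    have hxI : x ∈ I := hmemI x hax hxy.le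
    -- The slope at `x`: `hA` and `hB` say that the revenue curve lies below its tangent there, at
    -- `y` and at survival probability `1` respectively.
    set c := x - q x / f x with hc
    have hqx : 0 < q x := hqr.trans_le (hq hxr)
    have hcx : c < x := sub_lt_self _ (div_pos hqx (hfpos x hxI))
    have hA : q y * (y - c) ≤ q x * (x - c) := by
      refine mul_sub_le_of_density_ge (f := f) hxy.le hcx hq hq0 hq1 (fun t h1 h2 => ?_)
        fun u v k h1 h2 h3 hk hkf => ?_
      · have htI := hmemI t (hax.trans_le h1) h2
        have hm : c ≤ t - q t / f t := hmono hxI htI h1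
        have h4 : q t / f t ≤ t - c := by linarith
        rwa [div_le_iff₀ (hfpos t htI), mul_comm] at h4
      · have := mul_sub_le_leftCDF_sub hden h2
          (fun t ht => hmemI t (hax.trans_le (h1.trans ht.1)) (ht.2.trans h3)) hk hkf
        simp only [hqdef]
        linarith
    have hB : -c ≤ q x * (x - c) := by
      rcases le_or_gt 0 c with hc0 | hc0
      · have : 0 ≤ q x * (x - c) := mul_nonneg (hq0 x) (by linarith)
        linarith
      refine le_of_forall_pos_le_add fun η hη => ?_
      obtain ⟨u, hau, hux, hFu⟩ := hdist.exists_leftCDF_lt hs2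
        (hax.trans (hxy.trans (hyr.trans_le hrs2))) hax (div_pos hη (neg_pos.2 hc0))
      rw [lt_div_iff₀ (neg_pos.2 hc0)] at hFu
      have hle : q u * (u - c) ≤ q x * (x - c) := by
        refine mul_sub_le_of_density_le (f := f) hux.le (by linarith) hq hq0 hq1
          (fun t h1 h2 => ?_) fun u' v k h1 h2 h3 hk hkf => ?_
        · have htI := hmemI t (hau.trans_le h1) (h2.trans hxy.le)
          have hm : t - q t / f t ≤ c := hmono htI hxI h2
          have h4 : t - c ≤ q t / f t := by linarith
          rwa [le_div_iff₀ (hfpos t htI), mul_comm] at h4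
        · have := leftCDF_sub_le_mul_sub hden h2
            (fun t ht => hmemI t (hau.trans_le (h1.trans ht.1))
              (ht.2.trans (h3.trans hxy.le))) hk hkf
          simp only [hqdef]
          linarith
      have h5 : q u * -c ≤ q u * (u - c) :=
        mul_le_mul_of_nonneg_left (by linarith) (hq0 u)
      have h6 : q u * -c = -c - F u * -c := by
        simp only [hqdef]
        ring
      linarith
    have h7 : -c * F x ≤ x * q x := by
      simp only [hqdef] at hB ⊢
      linarith
    have h8 : 0 ≤ q x - q y := sub_nonneg.2 (hq hxy.le)
    have h9 := mul_le_mul_of_nonneg_right h7 h8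
    have h10 := mul_le_mul_of_nonneg_right hA hFx.le
    have h11 : F x = 1 - q x := by
      simp only [hqdef]
      ring
    have h12 : 0 ≤ x * q x * q y := mul_nonneg hrhs (hq0 y)
    have h13 : y * q y * F x ≤ x * q x * F x + -c * F x * (q x - q y) := by linarith
    have h14 : x * q x * F x = x * q x - x * q x * q x := by
      rw [h11]
      ring
    linarith
  have hK : 0 < q r * F x := mul_pos hqr hFx
  rw [mul_assoc, ← le_div_iff₀ hK]
  refine le_of_forall_lt_imp_le_of_dense fun y hy => ?_
  rw [le_div_iff₀ hK]
  rcases le_or_gt y x with hyx | hyx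
  · have h1 : q r * F x ≤ q x := by
      have := mul_le_of_le_one_right hqr.le (hF1 x)
      exact this.trans (hq hxr)
    exact (mul_le_mul_of_nonneg_right hyx hK.le).trans (mul_le_mul_of_nonneg_left h1 hx)
  · refine le_trans ?_ (hcore y hyx hy)
    rw [mul_assoc]
    exact mul_le_mul_of_nonneg_left (mul_le_mul_of_nonneg_right (hq hy.le) hFx.le) (by linarith)

/-! ### Learning from independent regular values -/

section tail

variable {n : ℕ} {μ : Measure (Fin n → ℝ)} [IsProbabilityMeasure μ]

lemma lintegral_min_one_sub_orderCDF_le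
    (h2 : ∀ v, 0 < v → 1 - orderCDF μ 1 v ≤ 4 * (1 - orderCDF μ 0 v) ^ 2) {A b T r : ℝ}
    (hA : ∀ r, 0 ≤ r → r * (1 - orderCDF μ 0 r) ≤ A) (hb : 0 ≤ b) (hT : 0 < T) (hr : 0 ≤ r) :
    ∫⁻ x in Ioi r, ENNReal.ofReal (min (1 - orderCDF μ 1 x) b) ≤
      ENNReal.ofReal (T * b + 4 * A ^ 2 / T) := by
  refine lintegral_Ioi_le_of_le_div_sq hb (by positivity) hT hr (fun x _ => min_le_right _ _)
    fun x hx => (min_le_left _ _).trans ?_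
  rw [le_div_iff₀ (by positivity)]
  have h0 : 0 ≤ x * (1 - orderCDF μ 0 x) :=
    mul_nonneg hx.le (sub_nonneg.2 (orderCDF_le_one μ 0 x))
  have h3 := pow_le_pow_left₀ h0 (hA x hx.le) 2
  have h4 := mul_le_mul_of_nonneg_right (h2 x hx) (sq_nonneg x)
  linarith

end tail

lemma nine_div_add_six_mul_le {ε β B : ℝ} (hε : 0 < ε) (hε1 : ε < 1) (hβ : 0 ≤ β)
    (hβB : β ≤ ε * B) : (9 / (4 * (ε / 16)) + 6) * β ≤ 42 * B := by
  have h1 : 9 / (4 * (ε / 16)) + 6 ≤ 42 / ε := by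
    rw [le_div_iff₀ hε, add_mul]
    have : 9 / (4 * (ε / 16)) * ε = 36 := by field_simp; norm_num
    linarith
  calc (9 / (4 * (ε / 16)) + 6) * β ≤ 42 / ε * (ε * B) := mul_le_mul h1 hβB hβ (by positivity)
    _ = 42 * B := by field_simp

/-- The loss consists of four terms of at most `ε / 16 * A`. Since `43008 = 42 * 1024`, the capped
error is at most `ε² / 1024`, which suits both reserves up to `8A / ε` and the splitting point `64A
/ ε`. -/
theorem learnsReserve_of_isRegular {n : ℕ} (hn : 1 ≤ n) (ν : Fin n → Measure ℝ)
    [∀ j, IsProbabilityMeasure (ν j)] (hν : ∀ j, IsRegular (ν j)) {m : ℕ} (hm : 1 ≤ m)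
    {ε δ : ℝ} (hε : 0 < ε) (hε1 : ε < 1) (hδ : 0 < δ) (hδ1 : δ < 1)
    (hβε : beta m δ ≤ ε ^ 3 / 43008) :
    LearnsReserve (Measure.pi ν) m δ fun r =>
      ENNReal.ofReal (1 - ε) * optimalRevenue (Measure.pi ν) ≤
        expectedRevenue r (Measure.pi ν) := by
  have hμ := ae_pi_nonneg ν fun j => (hν j).1.nonneg
  refine learnsReserve_of_revenueLoss _ hμ hm hδ hδ1 fun r' _ h => ?_
  have hβ := beta_nonneg hm hδ hδ1
  have h2 := fun v hv => one_sub_orderCDF_one_le ν hn (v := v) hv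
  set μ := Measure.pi ν with hμdef
  set Q : ℝ → ℝ := fun v => 1 - orderCDF μ 0 v with hQ
  have hQ0 : ∀ v, 0 ≤ Q v := fun v => sub_nonneg.2 (orderCDF_le_one μ 0 v)
  have hQanti : Antitone Q := fun u v huv => sub_le_sub_left (orderCDF_mono μ 0 huv) 1
  have hfin : optimalRevenue μ ≠ ⊤ := by
    have hx : ∀ j, ∃ x, 0 ≤ x ∧ 1 / 2 ≤ leftCDF (ν j) x := fun j => by
      obtain ⟨x, hx, hx0⟩ := (((tendsto_leftCDF_atTop (ν j)).eventually
        (lt_mem_nhds one_half_lt_one)).and (Filter.eventually_ge_atTop 0)).exists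
      exact ⟨x, hx0, hx.le⟩
    choose x hx0 hx1 using hx
    refine optimalRevenue_ne_top μ hμ (B := ∑ j, 2 * x j) (fun r hr => ?_) h2
    calc r * (1 - orderCDF μ 0 r) ≤ r * ∑ j, (1 - leftCDF (ν j) r) :=
          mul_le_mul_of_nonneg_left (one_sub_orderCDF_zero_le_sum ν hn r) hr
      _ = ∑ j, r * (1 - leftCDF (ν j) r) := Finset.mul_sum _ _ _
      _ ≤ ∑ j, 2 * x j := Finset.sum_le_sum fun j _ => ?_
    have hq0 : 0 ≤ 1 - leftCDF (ν j) r := sub_nonneg.2 (leftCDF_le_one _ r)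
    have hq1 := leftCDF_nonneg (ν j) r
    rcases le_total r (x j) with hrx | hrx
    · nlinarith [hx0 j]
    · have h3 := (hν j).mul_one_sub_leftCDF_mul_le (hx0 j) hrx
      have h4 := mul_le_mul_of_nonneg_left (hx1 j) (mul_nonneg hr hq0)
      have h5 := mul_le_of_le_one_right (hx0 j) (sub_le_self 1 (leftCDF_nonneg (ν j) (x j)))
      linarith
  have hA := fun r hr => mul_one_sub_orderCDF_le μ hμ hfin (r := r) hr
  set A := (optimalRevenue μ).toReal with hAdef
  have hOPT : optimalRevenue μ = ENNReal.ofReal A := (ENNReal.ofReal_toReal hfin).symm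
  rcases (ENNReal.toReal_nonneg : 0 ≤ (optimalRevenue μ).toReal).eq_or_lt with hA0 | hA0
  · rw [hOPT, hAdef, ← hA0]
    simp
  obtain ⟨x0, hx00, hx0le, hx0lt⟩ := exists_orderCDF_quantile μ hμ 0
    (show 0 ≤ 1 - ε / 8 by linarith) (by linarith)
  refine ofReal_one_sub_mul_optimalRevenue_le μ hfin (a := ε / 4) (b := ε / 4)
    (G := fun x => ε / 8 ≤ Q x) (by positivity) hε1.le (by linarith) (fun r hr => ?_)
    (fun r hr hG => ?_) h
  · rcases le_or_gt (ε / 8) (Q r) with hGr | hGr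
    · exact ⟨r, hr, hGr, mul_le_of_le_one_left zero_le (by rw [ENNReal.ofReal_le_one]; linarith)⟩
    have hx0Q : ε / 8 ≤ Q x0 := by
      simp only [hQ]
      linarith
    have hx0r : x0 < r := by
      by_contra hle
      exact absurd (hx0Q.trans (hQanti (not_lt.1 hle))) (not_le.2 hGr)
    refine ⟨x0, hx00, hx0Q, mul_expectedRevenue_le μ hμ (by linarith) (by linarith) hx00 hx0r.le ?_⟩
    change (1 - ε / 4) * (r * Q r) ≤ x0 * Q x0
    have hx0pos : 0 < Q x0 := lt_of_lt_of_le (by positivity) hx0Q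
    rw [← div_le_iff₀ hx0pos]
    -- At the quantile `x0` itself an atom may keep the CDF below `1 - ε / 8`, so the comparison is
    -- made at `x > x0`. It costs one factor `p` for regularity and one for passing from the sum
    -- back to `Q x`; `p * p ≥ 1 - ε / 4`.
    refine le_of_forall_gt_imp_ge_of_dense fun x hx => ?_
    rw [div_le_iff₀ hx0pos]
    have hrQ : 0 ≤ r * Q r := mul_nonneg hr (hQ0 r)
    rcases le_or_gt r x with hrx | hxr
    · have h3 : r * Q r ≤ x * Q x0 := mul_le_mul hrx (hQanti hx0r.le) (hQ0 r) (by linarith)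
      have h4 := mul_le_of_le_one_left hrQ (show 1 - ε / 4 ≤ 1 by linarith)
      linarith
    · have hx0' : 0 ≤ x := hx00.trans hx.le
      set p := orderCDF μ 0 x with hp
      have hp1 : 1 - ε / 8 < p := hx0lt x hx
      have hpsum : p * (r * Q r) ≤ x * ∑ j, (1 - leftCDF (ν j) x) := by
        calc p * (r * Q r) ≤ p * (r * ∑ j, (1 - leftCDF (ν j) r)) := by
              refine mul_le_mul_of_nonneg_left ?_ (orderCDF_nonneg μ 0 x)
              exact mul_le_mul_of_nonneg_left (one_sub_orderCDF_zero_le_sum ν hn r) hr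
          _ = ∑ j, r * (1 - leftCDF (ν j) r) * p := by
              rw [Finset.mul_sum, Finset.mul_sum]
              exact Finset.sum_congr rfl fun j _ => mul_comm _ _
          _ ≤ ∑ j, x * (1 - leftCDF (ν j) x) := by
              refine Finset.sum_le_sum fun j _ => le_trans ?_
                ((hν j).mul_one_sub_leftCDF_mul_le hx0' hxr.le)
              exact mul_le_mul_of_nonneg_left (orderCDF_zero_le_leftCDF ν hn x j)
                (mul_nonneg hr (sub_nonneg.2 (leftCDF_le_one _ r)))
          _ = x * ∑ j, (1 - leftCDF (ν j) x) := (Finset.mul_sum _ _ _).symm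
      have h3 := mul_le_mul_of_nonneg_left hpsum (orderCDF_nonneg μ 0 x)
      have h4 := mul_le_mul_of_nonneg_left (orderCDF_mul_sum_le ν hn x) hx0'
      have h5 : x * Q x ≤ x * Q x0 := mul_le_mul_of_nonneg_left (hQanti hx.le) hx0'
      have h6 : 1 - ε / 4 ≤ p * p := by nlinarith
      have h7 := mul_le_mul_of_nonneg_right h6 hrQ
      simp only [hQ] at h5 h7 hrQ ⊢
      simp only [← hμdef, ← hp] at h3 h4 h5 ⊢
      linarith
  · have hAR : cdfRevenue r (orderCDF μ 0) (orderCDF μ 1) ≤ ENNReal.ofReal A := by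
      rw [← expectedRevenue_eq_cdfRevenue μ hμ hr, ← hOPT]
      exact le_iSup₂_of_le r hr le_rfl
    have hb := nine_div_add_six_mul_le hε hε1 hβ (B := ε ^ 2 / 43008)
      (hβε.trans (le_of_eq (by ring)))
    have hb0 : 0 ≤ (9 / (4 * (ε / 16)) + 6) * beta m δ := by positivity
    refine (revenueLoss_le hβ (show 0 < ε / 16 by positivity) hr (measurable_orderCDF μ 1)
      (orderCDF_le_one μ 0) (orderCDF_le_one μ 1)).trans ?_
    generalize (9 / (4 * (ε / 16)) + 6) * beta m δ = b at hb hb0 ⊢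
    refine (add_le_add (mul_le_mul_right hAR _) (add_le_add
      (ENNReal.ofReal_le_ofReal (mul_le_mul_of_nonneg_left (min_le_right _ b) hr))
      (lintegral_min_one_sub_orderCDF_le h2 hA hb0 (show 0 < 64 * A / ε by positivity) hr))).trans ?_
    rw [hOPT, ← ENNReal.ofReal_mul (by positivity), ← ENNReal.ofReal_mul (by positivity),
      ← ENNReal.ofReal_add (by positivity) (by positivity),
      ← ENNReal.ofReal_add (by positivity) (by positivity)]
    refine ENNReal.ofReal_le_ofReal ?_
    have h3 : r * b ≤ ε / 16 * A := by
      have h4 : ε / 8 * r ≤ A := by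
        have := mul_le_mul_of_nonneg_left hG hr
        linarith [hA r hr]
      have h5 : r * b ≤ r * (42 * (ε ^ 2 / 43008)) := mul_le_mul_of_nonneg_left hb hr
      nlinarith
    have h4 : 64 * A / ε * b ≤ ε / 16 * A := by
      have h5 : 64 * A / ε * b ≤ 64 * A / ε * (42 * (ε ^ 2 / 43008)) :=
        mul_le_mul_of_nonneg_left hb (by positivity)
      have h6 : 64 * A / ε * (42 * (ε ^ 2 / 43008)) = ε / 16 * A := by
        field_simp
        ring
      linarith
    have h5 : 4 * A ^ 2 / (64 * A / ε) = ε / 16 * A := by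
      field_simp
      ring
    linarith

/-! ### MHR distributions -/

/-- The point `x` lies between `a` and `k * x` with weight at most `1 / k` on the latter, and `G`
vanishes at `a`. -/
lemma le_mul_of_concaveOn {D : Set ℝ} {G : ℝ → ℝ} (hG : ConcaveOn ℝ D G) {a x : ℝ} {k : ℕ}
    (hk : 1 ≤ k) (ha0 : 0 ≤ a) (hax : a < x) (haD : a ∈ D) (hkD : k * x ∈ D) (hGa : G a = 0)
    (hGk : G (k * x) ≤ 0) : G (k * x) ≤ k * G x := by
  have hk1 : (1 : ℝ) ≤ k := by exact_mod_cast hk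
  have hx0 : 0 < x := ha0.trans_lt hax
  have hxk : x ≤ k * x := le_mul_of_one_le_left hx0.le hk1
  have hpos : 0 < k * x - a := by linarith
  set l := (x - a) / (k * x - a) with hl
  have hl0 : 0 ≤ l := div_nonneg (by linarith) hpos.le
  have hl1 : l ≤ 1 := (div_le_one hpos).2 (by linarith)
  have hkl : k * l ≤ 1 := by
    rw [hl, mul_div_assoc', div_le_one hpos]
    nlinarith
  have h := hG.2 haD hkD (sub_nonneg.2 hl1) hl0 (sub_add_cancel 1 l)
  have hcomb : (1 - l) • a + l • (k * x) = x := by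
    have hlm : l * (k * x - a) = x - a := div_mul_cancel₀ _ hpos.ne'
    simp only [smul_eq_mul]
    linear_combination hlm
  rw [hcomb, hGa, smul_zero, zero_add, smul_eq_mul] at h
  nlinarith

lemma one_sub_leftCDF_le_pow {ν : Measure ℝ} {x y : ℝ} {k : ℕ}
    (hy : leftCDF ν y < 1) (hx : leftCDF ν x < 1)
    (h : logSurvival ν y ≤ k * logSurvival ν x) : 1 - leftCDF ν y ≤ (1 - leftCDF ν x) ^ k := by
  have := Real.exp_le_exp.2 h
  rwa [Real.exp_nat_mul, logSurvival, logSurvival, Real.exp_log (sub_pos.2 hy),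
    Real.exp_log (sub_pos.2 hx)] at this

section MHR

variable {ν : Measure ℝ}

lemma logSurvival_nonpos (v : ℝ) (hv : leftCDF ν v < 1) : logSurvival ν v ≤ 0 :=
  Real.log_nonpos (sub_pos.2 hv).le (sub_le_self _ (leftCDF_nonneg ν v))

lemma IsDiscreteMHR.measure_Iio {Δ : ℝ} (h : IsDiscreteMHR ν Δ) : ν (Iio Δ) = 0 := by
  obtain ⟨hΔ, hsupp, -⟩ := h
  refine measure_mono_null (fun v hv => ?_) (ae_iff.1 hsupp)
  rintro ⟨k, hk, rfl⟩
  have hk1 : (1 : ℝ) ≤ k := by exact_mod_cast hk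
  have hv' : k * Δ < Δ := hv
  nlinarith

lemma piecewiseLogSurvival_natCast_mul {Δ : ℝ} (hΔ : 0 < Δ) (k : ℕ) :
    piecewiseLogSurvival ν Δ (k * Δ) = logSurvival ν (k * Δ) := by
  rw [piecewiseLogSurvival, mul_div_cancel_right₀ _ hΔ.ne', Nat.floor_natCast, sub_self, zero_mul,
    add_zero]

lemma IsMHR.measure_Iio_zero (h : IsMHR ν) : ν (Iio 0) = 0 := by
  rcases h with h | ⟨Δ, h⟩
  · exact h.1.nonneg
  · exact measure_mono_null (Iio_subset_Iio h.1.le) h.measure_Iio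

variable [IsProbabilityMeasure ν]

lemma IsContinuousMHR.one_sub_leftCDF_le_pow (h : IsContinuousMHR ν) {x : ℝ} (hx : 0 ≤ x) {k : ℕ}
    (hk : 1 ≤ k) : 1 - leftCDF ν (k * x) ≤ (1 - leftCDF ν x) ^ k := by
  obtain ⟨hdist, hconc⟩ := h
  have hxk : x ≤ k * x := le_mul_of_one_le_left hx (by exact_mod_cast hk)
  rcases (leftCDF_le_one ν (k * x)).eq_or_lt with h1 | h1
  · rw [h1, sub_self]
    exact pow_nonneg (sub_nonneg.2 (leftCDF_le_one ν x)) k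
  have hx1 : leftCDF ν x < 1 := (leftCDF_mono ν hxk).trans_lt h1
  set a := sInf ν.support with ha
  have haS : a ∈ ν.support := hdist.sInf_mem
  have ha0 : leftCDF ν a = 0 := hdist.leftCDF_sInf
  rcases le_or_gt x a with hxa | hxa
  · have hx0 : leftCDF ν x = 0 := le_antisymm ((leftCDF_mono ν hxa).trans ha0.le)
      (leftCDF_nonneg ν x)
    rw [hx0, sub_zero, one_pow]
    exact sub_le_self _ (leftCDF_nonneg ν _)
  · obtain ⟨s, hs, hks⟩ := exists_mem_support_ge h1
    refine AnonymousReserve.one_sub_leftCDF_le_pow h1 hx1 (le_mul_of_concaveOn hconc hk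
      (hdist.support_subset haS) hxa ⟨haS, by rw [ha0]; exact one_pos⟩
      ⟨hdist.interval.out haS hs ⟨hxa.le.trans hxk, hks⟩, h1⟩ ?_ (logSurvival_nonpos _ h1))
    rw [logSurvival, ha0, sub_zero, Real.log_one]

/-- The factor `2` pays for rounding `x` up to a lattice point `a * Δ`, which is at most `2 * x`
once `a ≥ 2`; for `a ≤ 1` no mass lies below `x`. -/
lemma IsDiscreteMHR.one_sub_leftCDF_le_pow {Δ : ℝ} (h : IsDiscreteMHR ν Δ) {x : ℝ} {k : ℕ}
    (hk : 1 ≤ k) : 1 - leftCDF ν (2 * k * x) ≤ (1 - leftCDF ν x) ^ k := by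
  have hΔ := h.1
  have hΔ0 : leftCDF ν Δ = 0 := by
    rw [leftCDF, measureReal_def, h.measure_Iio, ENNReal.toReal_zero]
  set a := ⌈x / Δ⌉₊ with ha
  have hxa : x ≤ a * Δ := by
    rw [← div_le_iff₀ hΔ]
    exact Nat.le_ceil _
  have hk1 : (1 : ℝ) ≤ k := by exact_mod_cast hk
  rcases le_or_gt a 1 with ha1 | ha1
  · have ha1' : (a : ℝ) ≤ 1 := by exact_mod_cast ha1
    have hx0 : leftCDF ν x = 0 := le_antisymm
      ((leftCDF_mono ν (show x ≤ Δ by nlinarith)).trans hΔ0.le) (leftCDF_nonneg ν x)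
    rw [hx0, sub_zero, one_pow]
    exact sub_le_self _ (leftCDF_nonneg ν _)
  · have ha2 : (2 : ℝ) ≤ a := by exact_mod_cast ha1
    have hax : (a - 1) * Δ < x := by
      rw [← lt_div_iff₀ hΔ]
      have := Nat.ceil_lt_add_one (a := x / Δ) (by
        by_contra hneg
        rw [ha, Nat.ceil_eq_zero.2 (not_le.1 hneg).le] at ha1
        omega)
      linarith
    have hle : k * (a * Δ) ≤ 2 * k * x := by
      have h1 : a * Δ ≤ 2 * x := by nlinarith
      nlinarith
    refine (sub_le_sub_left (leftCDF_mono ν hle) 1).trans (le_trans ?_ (pow_le_pow_left₀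
      (sub_nonneg.2 (leftCDF_le_one ν _)) (sub_le_sub_left (leftCDF_mono ν hxa) 1) k))
    rcases (leftCDF_le_one ν (k * (a * Δ))).eq_or_lt with h1 | h1
    · rw [h1, sub_self]
      exact pow_nonneg (sub_nonneg.2 (leftCDF_le_one ν _)) k
    have haΔ : 0 < a * Δ := by positivity
    have hka : a * Δ ≤ k * (a * Δ) := le_mul_of_one_le_left haΔ.le hk1
    have h2 : leftCDF ν (a * Δ) < 1 := (leftCDF_mono ν hka).trans_lt h1
    have h0 : leftCDF ν 0 = 0 := le_antisymm ((leftCDF_mono ν hΔ.le).trans hΔ0.le)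
      (leftCDF_nonneg ν 0)
    have hzero : piecewiseLogSurvival ν Δ 0 = 0 := by
      have := piecewiseLogSurvival_natCast_mul (ν := ν) hΔ 0
      rw [Nat.cast_zero, zero_mul] at this
      rw [this, logSurvival, h0, sub_zero, Real.log_one]
    have hcast : (k : ℝ) * (a * Δ) = ((k * a : ℕ) : ℝ) * Δ := by
      push_cast
      ring
    have hGk : piecewiseLogSurvival ν Δ (k * (a * Δ)) = logSurvival ν (k * (a * Δ)) := by
      rw [hcast, piecewiseLogSurvival_natCast_mul hΔ]
    refine AnonymousReserve.one_sub_leftCDF_le_pow h1 h2 ?_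
    have := le_mul_of_concaveOn h.2.2 hk le_rfl haΔ ⟨le_rfl, by rw [h0]; exact one_pos⟩
      ⟨by positivity, h1⟩ hzero (by rw [hGk]; exact logSurvival_nonpos _ h1)
    rwa [hGk, piecewiseLogSurvival_natCast_mul hΔ] at this

lemma IsMHR.one_sub_leftCDF_le_pow (h : IsMHR ν) {x : ℝ} (hx : 0 ≤ x) {k : ℕ} (hk : 1 ≤ k) :
    1 - leftCDF ν (2 * k * x) ≤ (1 - leftCDF ν x) ^ k := by
  rcases h with h | ⟨Δ, h⟩
  · refine le_trans (sub_le_sub_left (leftCDF_mono ν ?_) 1) (h.one_sub_leftCDF_le_pow hx hk)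
    have : 0 ≤ k * x := by positivity
    linarith
  · exact h.one_sub_leftCDF_le_pow hk

end MHR

/-! ### Learning from independent MHR values -/

lemma sq_le_sixteen_pow (k : ℕ) : (k : ℝ) ^ 2 ≤ 16 ^ k := by
  have h : (k : ℝ) ≤ 2 ^ k := by exact_mod_cast Nat.lt_two_pow_self.le
  calc (k : ℝ) ^ 2 ≤ (2 ^ k) ^ 2 := pow_le_pow_left₀ (Nat.cast_nonneg k) h 2
    _ = 4 ^ k := by rw [← pow_mul, mul_comm, pow_mul]; norm_num
    _ ≤ 16 ^ k := pow_le_pow_left₀ (by norm_num) (by norm_num) k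

lemma mul_succ_le_sixteen_pow {k : ℕ} (hk : 2 ≤ k) : 64 * ((k : ℝ) + 1) ≤ 16 ^ k := by
  induction k, hk using Nat.le_induction with
  | base => norm_num
  | succ k hk ih =>
    rw [pow_succ]
    push_cast
    have : (0 : ℝ) ≤ k := Nat.cast_nonneg k
    linarith

section MHRtail

variable {n : ℕ} {ν : Fin n → Measure ℝ} [∀ j, IsProbabilityMeasure (ν j)]

/-- Each survival probability at `x` is at most `1 / 16` and their sum at most `1 / 8`. Keeping one
factor for the sum makes the bound independent of `n`. -/
lemma one_sub_orderCDF_two_mul_le (hn : 1 ≤ n) (hν : ∀ j, IsMHR (ν j)) {x : ℝ} (hx0 : 0 ≤ x)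
    (hx : 15 / 16 < orderCDF (Measure.pi ν) 0 x) {k : ℕ} (hk : 1 ≤ k) {v : ℝ} (hv : 2 * k * x ≤ v) :
    1 - orderCDF (Measure.pi ν) 0 v ≤ 2 / 16 ^ k := by
  obtain ⟨k, rfl⟩ := Nat.exists_eq_add_of_le' hk
  have hq0 : ∀ j, 0 ≤ 1 - leftCDF (ν j) x := fun j => sub_nonneg.2 (leftCDF_le_one _ x)
  have hq : ∀ j, 1 - leftCDF (ν j) x ≤ 1 / 16 := fun j => by
    linarith [orderCDF_zero_le_leftCDF ν hn x j]
  have hsum : ∑ j, (1 - leftCDF (ν j) x) ≤ 1 / 8 := by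
    have h1 := orderCDF_mul_sum_le ν hn x
    have h2 : 0 ≤ ∑ j, (1 - leftCDF (ν j) x) := Finset.sum_nonneg fun j _ => hq0 j
    nlinarith
  calc 1 - orderCDF (Measure.pi ν) 0 v
      ≤ 1 - orderCDF (Measure.pi ν) 0 (2 * (k + 1 : ℕ) * x) :=
        sub_le_sub_left (orderCDF_mono _ 0 hv) 1
    _ ≤ ∑ j, (1 - leftCDF (ν j) (2 * (k + 1 : ℕ) * x)) := one_sub_orderCDF_zero_le_sum ν hn _
    _ ≤ ∑ j, (1 / 16) ^ k * (1 - leftCDF (ν j) x) := by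
        refine Finset.sum_le_sum fun j _ => ((hν j).one_sub_leftCDF_le_pow hx0 hk).trans ?_
        rw [pow_succ]
        exact mul_le_mul_of_nonneg_right (pow_le_pow_left₀ (hq0 j) (hq j) k) (hq0 j)
    _ = (1 / 16) ^ k * ∑ j, (1 - leftCDF (ν j) x) := (Finset.mul_sum _ _ _).symm
    _ ≤ (1 / 16) ^ k * (1 / 8) := mul_le_mul_of_nonneg_left hsum (by positivity)
    _ = 2 / 16 ^ (k + 1) := by
        rw [one_div_pow, pow_succ]
        field_simp
        norm_num

lemma one_sub_orderCDF_mul_sq_le (hn : 1 ≤ n) (hν : ∀ j, IsMHR (ν j)) {x : ℝ} (hx0 : 0 < x)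
    (hx : 15 / 16 < orderCDF (Measure.pi ν) 0 x) {v : ℝ} (hv : 0 ≤ v) :
    (1 - orderCDF (Measure.pi ν) 0 v) * v ^ 2 ≤ 32 * x ^ 2 := by
  have hQ0 : 0 ≤ 1 - orderCDF (Measure.pi ν) 0 v := sub_nonneg.2 (orderCDF_le_one _ 0 v)
  have hQ1 : 1 - orderCDF (Measure.pi ν) 0 v ≤ 1 := sub_le_self _ (orderCDF_nonneg _ 0 v)
  have h1 : (⌊v / (2 * x)⌋₊ : ℝ) ≤ v / (2 * x) := Nat.floor_le (by positivity)
  have h2 : v / (2 * x) < ⌊v / (2 * x)⌋₊ + 1 := Nat.lt_floor_add_one _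
  rw [le_div_iff₀ (by positivity)] at h1
  rw [div_lt_iff₀ (by positivity)] at h2
  generalize ⌊v / (2 * x)⌋₊ = k at h1 h2
  rcases Nat.eq_zero_or_pos k with rfl | hk
  · rw [Nat.cast_zero, zero_add, one_mul] at h2
    have := mul_le_of_le_one_left (sq_nonneg v) hQ1
    nlinarith
  · have hk1 : (1 : ℝ) ≤ k := by exact_mod_cast hk
    have h3 := one_sub_orderCDF_two_mul_le hn hν hx0.le hx hk (v := v) (by linarith)
    rw [le_div_iff₀ (by positivity)] at h3
    have h4 : v ≤ 4 * k * x := by nlinarith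
    have h5 : v ^ 2 ≤ (4 * k * x) ^ 2 := pow_le_pow_left₀ hv h4 2
    have h6 := mul_le_mul_of_nonneg_left (sq_le_sixteen_pow k) hQ0
    have h7 : (1 - orderCDF (Measure.pi ν) 0 v) * (k : ℝ) ^ 2 ≤ 2 := h6.trans h3
    calc (1 - orderCDF (Measure.pi ν) 0 v) * v ^ 2
        ≤ (1 - orderCDF (Measure.pi ν) 0 v) * (4 * k * x) ^ 2 :=
          mul_le_mul_of_nonneg_left h5 hQ0
      _ = (1 - orderCDF (Measure.pi ν) 0 v) * (k : ℝ) ^ 2 * (16 * x ^ 2) := by ring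
      _ ≤ 2 * (16 * x ^ 2) := mul_le_mul_of_nonneg_right h7 (by positivity)
      _ = 32 * x ^ 2 := by ring

/-- Up to `4 * x` the factor `1 / 64` suffices; beyond, geometric decay beats the linear growth of
`r`. -/
lemma mul_one_sub_orderCDF_le_div (hn : 1 ≤ n) (hν : ∀ j, IsMHR (ν j)) {x : ℝ} (hx0 : 0 < x)
    (hx : 15 / 16 < orderCDF (Measure.pi ν) 0 x) {r : ℝ} (hr : 0 ≤ r)
    (hQ : 1 - orderCDF (Measure.pi ν) 0 r ≤ 1 / 64) :
    r * (1 - orderCDF (Measure.pi ν) 0 r) ≤ x / 16 := by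
  have hQ0 : 0 ≤ 1 - orderCDF (Measure.pi ν) 0 r := sub_nonneg.2 (orderCDF_le_one _ 0 r)
  rcases le_or_gt r (4 * x) with h4 | h4
  · nlinarith
  have h1 : (⌊r / (2 * x)⌋₊ : ℝ) ≤ r / (2 * x) := Nat.floor_le (by positivity)
  have h2 : r / (2 * x) < ⌊r / (2 * x)⌋₊ + 1 := Nat.lt_floor_add_one _
  have hk : 2 ≤ ⌊r / (2 * x)⌋₊ := by
    rw [Nat.le_floor_iff (by positivity), le_div_iff₀ (by positivity)]
    push_cast
    linarith
  rw [le_div_iff₀ (by positivity)] at h1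
  rw [div_lt_iff₀ (by positivity)] at h2
  generalize ⌊r / (2 * x)⌋₊ = k at h1 h2 hk
  have h3 := one_sub_orderCDF_two_mul_le hn hν hx0.le hx (by omega : 1 ≤ k) (v := r) (by linarith)
  have hpow : (0 : ℝ) < 16 ^ k := by positivity
  calc r * (1 - orderCDF (Measure.pi ν) 0 r) ≤ (k + 1) * (2 * x) * (2 / 16 ^ k) :=
        mul_le_mul h2.le h3 hQ0 (by positivity)
    _ = x / 16 * (64 * (k + 1) / 16 ^ k) := by ring
    _ ≤ x / 16 * 1 := by
        refine mul_le_mul_of_nonneg_left ?_ (by positivity)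
        rw [div_le_one hpow]
        exact mul_succ_le_sixteen_pow hk
    _ = x / 16 := mul_one _

end MHRtail

/-- Keeps the square root instead of applying AM-GM, for use when `√Q` itself has an integral of
order `OPT`. -/
lemma lintegral_loss_le_sqrt {β r : ℝ} (hβ : 0 ≤ β) {Q : ℝ → ℝ} (hQ : Measurable Q) :
    ∫⁻ x in Ioi r, ENNReal.ofReal (loss β (Q x)) ≤
      (ENNReal.ofReal (3 * √β) * ∫⁻ x in Ioi r, ENNReal.ofReal (√(Q x))) +
        ∫⁻ x in Ioi r, ENNReal.ofReal (min (Q x) (6 * β)) := by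
  rw [← lintegral_const_mul _ hQ.sqrt.ennreal_ofReal,
    ← lintegral_add_left (hQ.sqrt.ennreal_ofReal.const_mul _)]
  refine lintegral_mono fun x => ?_
  rw [← ENNReal.ofReal_mul (by positivity)]
  refine le_trans (ENNReal.ofReal_le_ofReal ?_) ENNReal.ofReal_add_le
  have h : 3 * √(β * Q x) = 3 * √β * √(Q x) := by rw [Real.sqrt_mul hβ, mul_assoc]
  have hs : 0 ≤ 3 * √β * √(Q x) := by positivity
  rw [loss, h]
  rcases min_choice (Q x) (6 * β) with hm | hm <;> rw [hm]
  · exact (min_le_left _ _).trans (le_add_of_nonneg_left hs)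
  · exact min_le_right _ _

theorem learnsReserve_of_isMHR {n : ℕ} (hn : 1 ≤ n) (ν : Fin n → Measure ℝ)
    [∀ j, IsProbabilityMeasure (ν j)] (hν : ∀ j, IsMHR (ν j)) {m : ℕ} (hm : 1 ≤ m)
    {ε δ : ℝ} (hε : 0 < ε) (hε1 : ε < 1) (hδ : 0 < δ) (hδ1 : δ < 1)
    (hβε : beta m δ ≤ ε ^ 2 / 10 ^ 12) :
    LearnsReserve (Measure.pi ν) m δ fun r =>
      ENNReal.ofReal (1 - ε) * optimalRevenue (Measure.pi ν) ≤
        expectedRevenue r (Measure.pi ν) := by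
  have hμ := ae_pi_nonneg ν fun j => (hν j).measure_Iio_zero
  refine learnsReserve_of_revenueLoss _ hμ hm hδ hδ1 fun r' _ h => ?_
  have hβ := beta_nonneg hm hδ hδ1
  have h2 := fun v hv => one_sub_orderCDF_one_le ν hn (v := v) hv
  obtain ⟨x0, hx00, hx0le, hx0lt⟩ := exists_orderCDF_quantile (Measure.pi ν) hμ 0
    (show (0 : ℝ) ≤ 15 / 16 by norm_num) (by norm_num)
  have htail : ∀ v, 0 ≤ v → (1 - orderCDF (Measure.pi ν) 0 v) * v ^ 2 ≤ 32 * x0 ^ 2 := by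
    intro v hv
    have hcont : Continuous fun x : ℝ => 32 * x ^ 2 := by fun_prop
    refine ge_of_tendsto ((hcont.tendsto x0).mono_left (nhdsWithin_le_nhds (s := Ioi x0))) ?_
    filter_upwards [self_mem_nhdsWithin] with x hx
    exact one_sub_orderCDF_mul_sq_le hn hν (hx00.trans_lt hx) (hx0lt x hx) hv
  have hdom : ∀ r, 0 ≤ r → 1 - orderCDF (Measure.pi ν) 0 r ≤ 1 / 64 →
      r * (1 - orderCDF (Measure.pi ν) 0 r) ≤ x0 / 16 := by
    intro r hr hQr
    rw [le_div_iff₀ (by norm_num)]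
    refine le_of_forall_gt_imp_ge_of_dense fun x hx => ?_
    rw [← le_div_iff₀ (by norm_num)]
    exact mul_one_sub_orderCDF_le_div hn hν (hx00.trans_lt hx) (hx0lt x hx) hr hQr
  set μ := Measure.pi ν with hμdef
  set Q : ℝ → ℝ := fun v => 1 - orderCDF μ 0 v with hQ
  have hQ0 : ∀ v, 0 ≤ Q v := fun v => sub_nonneg.2 (orderCDF_le_one μ 0 v)
  have hQanti : Antitone Q := fun u v huv => sub_le_sub_left (orderCDF_mono μ 0 huv) 1
  have hfin : optimalRevenue μ ≠ ⊤ := by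
    refine optimalRevenue_ne_top μ hμ (B := 1 + 32 * x0 ^ 2) (fun r hr => ?_) h2
    have h3 := htail r hr
    have h4 : 1 - orderCDF μ 0 r ≤ 1 := sub_le_self _ (orderCDF_nonneg μ 0 r)
    have h5 : 0 ≤ 1 - orderCDF μ 0 r := hQ0 r
    nlinarith [mul_nonneg h5 (sq_nonneg (r - 1))]
  have hA := fun r hr => mul_one_sub_orderCDF_le μ hμ hfin (r := r) hr
  set A := (optimalRevenue μ).toReal with hAdef
  have hOPT : optimalRevenue μ = ENNReal.ofReal A := (ENNReal.ofReal_toReal hfin).symm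
  rcases (ENNReal.toReal_nonneg : 0 ≤ (optimalRevenue μ).toReal).eq_or_lt with hA0 | hA0
  · rw [hOPT, hAdef, ← hA0]
    simp
  have hx0Q : 1 / 16 ≤ Q x0 := by
    simp only [hQ]
    linarith
  have hx0A : x0 ≤ 16 * A := by
    have h3 := hA x0 hx00
    have h4 := mul_le_mul_of_nonneg_left hx0Q hx00
    simp only [hQ] at h4
    linarith
  -- No factor is lost here: a reserve `r` with `Q r < 1 / 64` has first term at most `x0 / 16 ≤ x0
  -- * Q x0`.
  refine ofReal_one_sub_mul_optimalRevenue_le μ hfin (a := 0) (b := ε / 2)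
    (G := fun x => 1 / 64 ≤ Q x) (by positivity) hε1.le (by linarith) (fun r hr => ?_)
    (fun r hr hG => ?_) h
  · rcases le_or_gt (1 / 64) (Q r) with hGr | hGr
    · exact ⟨r, hr, hGr, by simp⟩
    have hx0r : x0 < r := by
      by_contra hle
      have := hQanti (not_lt.1 hle)
      linarith
    refine ⟨x0, hx00, by linarith, mul_expectedRevenue_le μ hμ (by norm_num) (by norm_num) hx00
      hx0r.le ?_⟩
    have h3 := hdom r hr hGr.le
    have h4 := mul_le_mul_of_nonneg_left hx0Q hx00
    simp only [hQ] at h4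
    linarith
  · have hb := nine_div_add_six_mul_le hε hε1 hβ (B := ε / 10 ^ 12)
      (hβε.trans (le_of_eq (by ring)))
    have hr64 : r ≤ 64 * A := by
      have h3 := hA r hr
      have h4 := mul_le_mul_of_nonneg_left hG hr
      simp only [hQ] at h4
      linarith
    have hfirst : ENNReal.ofReal (r * loss (beta m δ) (1 - orderCDF μ 0 r)) ≤
        ENNReal.ofReal (ε / 8 * A) := by
      refine ENNReal.ofReal_le_ofReal ?_
      have h3 := mul_le_mul_of_nonneg_left (loss_le hβ (hQ0 r) (show 0 < ε / 16 by positivity)) hr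
      have h4 := mul_le_mul_of_nonneg_left ((min_le_right (Q r) _).trans hb) hr
      have h5 := mul_le_mul_of_nonneg_left (hA r hr) (show 0 ≤ ε / 16 by positivity)
      have h6 := mul_le_mul_of_nonneg_right hr64 (show 0 ≤ 42 * (ε / 10 ^ 12) by positivity)
      have h7 : 0 ≤ ε * A := by positivity
      simp only [hQ] at h3 h4
      linarith
    -- `√(1 - F₂) ≤ 2 * Q x ≤ 64 * x0² / x²`, and `x0 ≤ 16 * A` gives `64 * 256 = 16384`; the split
    -- is at `A`.
    have hsqrt : ∫⁻ x in Ioi r, ENNReal.ofReal (√(1 - orderCDF μ 1 x)) ≤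
        ENNReal.ofReal (A * 1 + 16384 * A ^ 2 / A) := by
      refine lintegral_Ioi_le_of_le_div_sq zero_le_one (by positivity) hA0 hr (fun x _ => ?_)
        fun x hx => ?_
      · refine Real.sqrt_le_iff.2 ⟨zero_le_one, ?_⟩
        rw [one_pow]
        exact sub_le_self _ (orderCDF_nonneg μ 1 x)
      · have h3 : √(1 - orderCDF μ 1 x) ≤ 2 * Q x := by
          refine Real.sqrt_le_iff.2 ⟨by linarith [hQ0 x], (h2 x hx).trans (le_of_eq ?_)⟩
          simp only [hQ]
          ring
        refine h3.trans ?_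
        rw [le_div_iff₀ (by positivity)]
        have h4 := htail x hx.le
        have h5 := pow_le_pow_left₀ hx00 hx0A 2
        simp only [hQ]
        linarith
    have hsqrtβ : √(beta m δ) ≤ ε / 10 ^ 6 := by
      refine Real.sqrt_le_iff.2 ⟨by positivity, hβε.trans (le_of_eq ?_)⟩
      ring
    have hmin := lintegral_min_one_sub_orderCDF_le h2 hA (show 0 ≤ 6 * beta m δ by positivity)
      (show 0 < 64 * A / ε by positivity) hr
    rw [revenueLoss, hOPT, ← ENNReal.ofReal_mul (by positivity)]
    refine (add_le_add hfirst ((lintegral_loss_le_sqrt hβ ((measurable_orderCDF μ 1).const_sub 1)).trans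
      (add_le_add (mul_le_mul_right hsqrt _) hmin))).trans ?_
    rw [← ENNReal.ofReal_mul (by positivity),
      ← ENNReal.ofReal_add (by positivity) (by positivity),
      ← ENNReal.ofReal_add (by positivity) (by positivity)]
    refine ENNReal.ofReal_le_ofReal ?_
    have h3 : 3 * √(beta m δ) * (A * 1 + 16384 * A ^ 2 / A) ≤ ε / 8 * A := by
      have h4 : A * 1 + 16384 * A ^ 2 / A = 16385 * A := by
        field_simp
        ring
      rw [h4]
      have h5 := mul_le_mul_of_nonneg_right hsqrtβ hA0.le
      have h6 : 0 ≤ ε * A := by positivity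
      linarith
    have h4 : 64 * A / ε * (6 * beta m δ) ≤ ε / 16 * A := by
      have h5 := mul_le_mul_of_nonneg_left hβε (show 0 ≤ 384 * A / ε by positivity)
      have h6 : 384 * A / ε * (ε ^ 2 / 10 ^ 12) = 384 / 10 ^ 12 * (ε * A) := by
        field_simp
      have h7 : 64 * A / ε * (6 * beta m δ) = 384 * A / ε * beta m δ := by ring
      have h8 : 0 ≤ ε * A := by positivity
      rw [h7]
      linarith
    have h5 : 4 * A ^ 2 / (64 * A / ε) = ε / 16 * A := by
      field_simp
      ring
    have h6 : 0 ≤ ε * A := by positivity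
    linarith

end AnonymousReserve

/-! ### A common constant for the four families. -/

theorem mainTheorem1 :
    ∃ C : ℝ, 0 < C ∧ ∀ (ε δ : ℝ), 0 < ε → ε < 1 → 0 < δ → δ < 1 →
      ∀ (n : ℕ), 1 ≤ n → ∀ (m : ℕ),
      -- values in `[0, 1]`, arbitrarily correlated
      (∀ (μ : Measure (Fin n → ℝ)) [IsProbabilityMeasure μ],
        (∀ᵐ s ∂μ, ∀ j, s j ∈ Icc (0 : ℝ) 1) →
        C * (1 / ε ^ 2) * (Real.log (1 / ε) + Real.log (1 / δ) + 1) ≤ m →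
        AnonymousReserve.LearnsReserve μ m δ (fun r =>
          AnonymousReserve.optimalRevenue μ ≤
            AnonymousReserve.expectedRevenue r μ + ENNReal.ofReal ε)) ∧
      -- values in `[1, H]`, arbitrarily correlated
      (∀ (H : ℝ), 1 ≤ H → ∀ (μ : Measure (Fin n → ℝ)) [IsProbabilityMeasure μ],
        (∀ᵐ s ∂μ, ∀ j, s j ∈ Icc 1 H) →
        C * (1 / ε ^ 2) * H * (Real.log (1 / ε) + Real.log H + Real.log (1 / δ) + 1) ≤ m →
        AnonymousReserve.LearnsReserve μ m δ (fun r =>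
          ENNReal.ofReal (1 - ε) * AnonymousReserve.optimalRevenue μ ≤
            AnonymousReserve.expectedRevenue r μ)) ∧
      -- independent continuous regular values
      (∀ (ν : Fin n → Measure ℝ) [∀ j, IsProbabilityMeasure (ν j)],
        (∀ j, AnonymousReserve.IsRegular (ν j)) →
        C * (1 / ε ^ 3) * (Real.log (1 / ε) + Real.log (1 / δ) + 1) ≤ m →
        AnonymousReserve.LearnsReserve (Measure.pi ν) m δ (fun r =>
          ENNReal.ofReal (1 - ε) * AnonymousReserve.optimalRevenue (Measure.pi ν) ≤
            AnonymousReserve.expectedRevenue r (Measure.pi ν))) ∧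
      -- independent MHR values, each of them discrete or continuous
      (∀ (ν : Fin n → Measure ℝ) [∀ j, IsProbabilityMeasure (ν j)],
        (∀ j, AnonymousReserve.IsMHR (ν j)) →
        C * (1 / ε ^ 2) * (Real.log (1 / ε) + Real.log (1 / δ) + 1) ≤ m →
        AnonymousReserve.LearnsReserve (Measure.pi ν) m δ (fun r =>
          ENNReal.ofReal (1 - ε) * AnonymousReserve.optimalRevenue (Measure.pi ν) ≤
            AnonymousReserve.expectedRevenue r (Measure.pi ν))) := by
  obtain ⟨C, hC, hCβ⟩ :=
    AnonymousReserve.exists_beta_le (show (0 : ℝ) < 1 / 10 ^ 12 by positivity)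
  refine ⟨3 * C, by positivity, fun ε δ hε hε1 hδ hδ1 n hn m => ?_⟩
  have hlε : 0 ≤ Real.log (1 / ε) := Real.log_nonneg (one_le_one_div hε hε1.le)
  have hlδ : 0 ≤ Real.log (1 / δ) := Real.log_nonneg (one_le_one_div hδ hδ1.le)
  have hpow : ∀ k : ℕ, 1 ≤ 1 / ε ^ k := fun k => one_le_one_div (by positivity)
    (pow_le_one₀ hε.le hε1.le)
  have hlog : ∀ k : ℕ, Real.log (1 / ε ^ k) = k * Real.log (1 / ε) := fun k => by
    rw [← one_div_pow, Real.log_pow]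
  -- `exists_beta_le` is applied with `K = H / ε ^ k`; the factor `3` in the constant absorbs `ln (1
  -- / ε ^ k) = k * ln (1 / ε)`.
  have key : ∀ k : ℕ, k ≤ 3 → ∀ H : ℝ, 1 ≤ H →
      3 * C * (1 / ε ^ k) * H * (Real.log (1 / ε) + Real.log H + Real.log (1 / δ) + 1) ≤ m →
      1 ≤ m ∧ AnonymousReserve.beta m δ ≤ ε ^ k / H / 10 ^ 12 := by
    intro k hk H hH hm
    have hk3 : (k : ℝ) ≤ 3 := by exact_mod_cast hk
    have hlH : 0 ≤ Real.log H := Real.log_nonneg hH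
    have hK1 : 1 ≤ 1 / ε ^ k * H := one_le_mul_of_one_le_of_one_le (hpow k) hH
    have h := hCβ (1 / ε ^ k * H) δ m hK1 hδ hδ1 (le_trans ?_ hm)
    · refine ⟨h.1, h.2.trans (le_of_eq ?_)⟩
      have : 0 < H := by linarith
      field_simp
    · rw [Real.log_mul (by positivity) (by positivity), hlog]
      have h1 : k * Real.log (1 / ε) + Real.log H + Real.log (1 / δ) + 1 ≤
          3 * (Real.log (1 / ε) + Real.log H + Real.log (1 / δ) + 1) := by
        have := mul_le_mul_of_nonneg_right hk3 hlε
        linarith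
      have h2 := mul_le_mul_of_nonneg_left h1 (show 0 ≤ C * (1 / ε ^ k * H) by positivity)
      linarith
  have key1 : ∀ k : ℕ, k ≤ 3 →
      3 * C * (1 / ε ^ k) * (Real.log (1 / ε) + Real.log (1 / δ) + 1) ≤ m →
      1 ≤ m ∧ AnonymousReserve.beta m δ ≤ ε ^ k / 10 ^ 12 := by
    intro k hk hm
    have h := key k hk 1 le_rfl (by rwa [Real.log_one, add_zero, mul_one])
    rwa [div_one] at h
  refine ⟨fun μ _ hμ hm => ?_, fun H hH μ _ hμ hm => ?_, fun ν _ hν hm => ?_, fun ν _ hν hm => ?_⟩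
  · obtain ⟨hm1, hβ⟩ := key1 2 (by norm_num) hm
    refine AnonymousReserve.learnsReserve_of_mem_Icc_zero_one μ hμ hm1 hε hε1 hδ hδ1
      (hβ.trans ?_)
    gcongr
    norm_num
  · obtain ⟨hm1, hβ⟩ := key 2 (by norm_num) H hH hm
    refine AnonymousReserve.learnsReserve_of_mem_Icc_one hn μ hH hμ hm1 hε hε1 hδ hδ1
      (hβ.trans ?_)
    gcongr
    norm_num
  · obtain ⟨hm1, hβ⟩ := key1 3 le_rfl hm
    refine AnonymousReserve.learnsReserve_of_isRegular hn ν hν hm1 hε hε1 hδ hδ1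
      (hβ.trans ?_)
    gcongr
    norm_num
  · obtain ⟨hm1, hβ⟩ := key1 2 (by norm_num) hm
    exact AnonymousReserve.learnsReserve_of_isMHR hn ν hν hm1 hε hε1 hδ hδ1 hβ
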